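/- **Setting.** Let $\sigma>0$ and let $V(x,y_1,\dots,y_N)=V_0(x)+V_1(x,y_1,\dots,y_N)$ on $\mathbb R^d\times(\mathbb T^d)^N$ (with $\mathbb T^d=\mathbb R^d/\mathbb Z^d$), where $V_0$ is smooth, $e^{-V_0/\sigma}\in L^1(\mathbb R^d)$, $V_0(x)\to\infty$ as $|x|\to\infty$, $\nabla^2V_0$ is bounded, and $V_1$ is smooth, bounded and $1$-periodic in each coordinate of $y_1,\dots,y_N$. Put $\operatorname{osc}(V_1)=\sup V_1-\inf V_1$ and, for $\varepsilon>0$, $V^\varepsilon(x)=V(x,x/\varepsilon,\dots,x/\varepsilon^N)$. Let $Z(x)=\int_{(\mathbb T^d)^N}e^{-V(x,y)/\sigma}\,dy$ and $\Psi=-\sigma\log Z$. Set $\mathcal K_N=e^{-V/\sigma}I$ and, for $k=N,\dots,1$, let $\theta_k(x,y_1,\dots,y_{k-1},\cdot)\in H^1(\mathbb T^d)^d$ be the weak solution (unique up to constants) of $\nabla_{y_k}\cdot\big(\mathcal K_k(I+\nabla_{y_k}\theta_k^\top)\big)=0$, where $(\nabla\theta^\top)_{ij}=\partial_i\theta^j$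 and the divergence acts on columns, and $\mathcal K_{k-1}=\int_{\mathbb T^d}\mathcal K_k(I+\nabla_{y_k}\theta_k^\top)\,dy_k$. The effective diffusion tensor is $\mathcal M(x)=\mathcal K_0(x)/Z(x)$. Let $\pi_{ref}$, $\pi^\varepsilon$, $\pi^0$ be the probability measures on $\mathbb R^d$ with densities proportional to $e^{-V_0/\sigma}$, $e^{-V^\varepsilon/\sigma}$ and $Z=e^{-\Psi/\sigma}$. Let $P_t$, $P_t^\varepsilon$, $P_t^0$ be the strongly continuous semigroups on $L^2(\pi_{ref})$, $L^2(\pi^\varepsilon)$, $L^2(\pi^0)$ whose generators are the closures (the self-adjoint extensions) of the operators given on $C_c^\infty(\mathbb R^d)$ by $$-\nabla V_0\cdot\nabla f+\sigma\Delta f,\qquad -\nabla V^\varepsilon\cdot\nabla f+\sigma\Delta f,\qquad \frac{\sigma}{Z}\nabla\cdot(Z\mathcal M\nabla f);$$ these are the semigroups of the reference dynamics $dZ_t=-\nabla V_0(Z_t)dt+\sqrt{2\sigma}\,dW_t$, the full dynamics $dX^\varepsilon_t=-\nabla V^\varepsilon(X^\varepsilon_t)dt+\sqrt{2\sigma}\,dW_t$,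 and the homogenized dynamics $dX^0_t=-\mathcal M\nabla\Psi(X^0_t)dt+\sigma\nabla\cdot\mathcal M(X^0_t)dt+\sqrt{2\sigma\mathcal M(X^0_t)}\,dW_t$. **Proposition.** Let $\rho>0$. 1. The Poincaré inequality $$\operatorname{Var}_{\pi_{ref}}(f)\le\frac{\sigma}{\rho}\int|\nabla f|^2\,d\pi_{ref}\qquad\text{for all } f\in H^1(\pi_{ref})\tag{P}$$ is equivalent to $$\operatorname{Var}_{\pi_{ref}}(P_tf)\le e^{-2\rho t}\operatorname{Var}_{\pi_{ref}}(f)\qquad\text{for all } f\in L^2(\pi_{ref}),\ t\ge0.$$ 2. If (P) holds, then for every $\varepsilon>0$ and every $f\in L^2(\pi_{ref})$ one has $f\in L^2(\pi^\varepsilon)\cap L^2(\pi^0)$ and, for all $t\ge0$, $$\operatorname{Var}_{\pi^\varepsilon}(P^\varepsilon_tf)\le e^{-2\gamma t}\operatorname{Var}_{\pi^\varepsilon}(f),\qquad \gamma=\rho\,e^{-2\operatorname{osc}(V_1)/\sigma},$$ $$\operatorname{Var}_{\pi^0}(P^0_tf)\le e^{-2\widetilde\gamma t}\operatorname{Var}_{\pi^0}(f),\qquad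 \widetilde\gamma=\rho\,e^{-3\operatorname{osc}(V_1)/\sigma}.$$ -/

import Mathlib

open MeasureTheory ProbabilityTheory Filter Topology
open scoped NNReal ENNReal Matrix ContDiff InnerProductSpace

noncomputable section

/-- The Euclidean space `ℝᵈ`. -/
abbrev Space (d : ℕ) : Type := EuclideanSpace ℝ (Fin d)

/-! ### The torus `𝕋ᵈ = ℝᵈ/ℤᵈ`

Functions on the torus are `ℤᵈ`-periodic functions on `ℝᵈ`; integrals over the torus are integrals
over the unit cell `[0,1)ᵈ`. -/

/-- The unit cell `[0,1)ᵈ`. -/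
def unitCell (d : ℕ) : Set (Space d) := {z | ∀ i, z i ∈ Set.Ico (0 : ℝ) 1}

/-- Lebesgue measure on the torus. -/
def torusVolume (d : ℕ) : Measure (Space d) := volume.restrict (unitCell d)

/-- Membership in `C^∞(𝕋ᵈ)`. -/
def IsSmoothPeriodic {d : ℕ} (φ : Space d → ℝ) : Prop :=
  ContDiff ℝ ∞ φ ∧ ∀ (i : Fin d) (z : Space d), φ (z + EuclideanSpace.single i 1) = φ z

/-- `θ ∈ H¹(𝕋ᵈ)` with gradient `G`, where `H¹(𝕋ᵈ)` is the completion of `C^∞(𝕋ᵈ)` in the norm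
`(‖θ‖²_{L²(𝕋ᵈ)} + ‖∇θ‖²_{L²(𝕋ᵈ)})^{1/2}`. -/
def IsTorusSobolev {d : ℕ} (θ : Space d → ℝ) (G : Space d → Space d) : Prop :=
  MemLp θ 2 (torusVolume d) ∧ MemLp G 2 (torusVolume d) ∧
    ∃ φ : ℕ → Space d → ℝ, (∀ n, IsSmoothPeriodic (φ n)) ∧
      Tendsto (fun n => eLpNorm (φ n - θ) 2 (torusVolume d)) atTop (𝓝 0) ∧
      Tendsto (fun n => eLpNorm (gradient (φ n) - G) 2 (torusVolume d)) atTop (𝓝 0)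

/-! ### Correctors and the effective diffusion tensor -/

/-- `θ ∈ H¹(𝕋ᵈ)`, with gradient `G`, is a weak solution of the `j`-th component
`∇ · (A (∇θ + e_j)) = 0` of the corrector equation on the torus. -/
def IsCorrector {d : ℕ} (A : Space d → Matrix (Fin d) (Fin d) ℝ) (j : Fin d)
    (θ : Space d → ℝ) (G : Space d → Space d) : Prop :=
  IsTorusSobolev θ G ∧
    ∀ φ : Space d → ℝ, IsSmoothPeriodic φ →
      ∫ z, (gradient φ z).ofLp ⬝ᵥ (A z *ᵥ (G z + EuclideanSpace.single j 1).ofLp)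
        ∂(torusVolume d) = 0

open Classical in
/-- The gradient `∇θ^j` of the `j`-th component of the corrector of the coefficient field `A`
(for uniformly elliptic `A` it exists and is unique up to a null set). -/
def correctorGradient {d : ℕ} (A : Space d → Matrix (Fin d) (Fin d) ℝ) (j : Fin d) :
    Space d → Space d :=
  if h : ∃ G : Space d → Space d, ∃ θ : Space d → ℝ, IsCorrector A j θ G then h.choose else 0

/-- One step of homogenization: the matrix `∫_{𝕋ᵈ} A (I + ∇θᵀ) dz`, where `(∇θᵀ)_{ij} = ∂_i θ^j`
and `θ = (θ^1, …, θ^d)` is the corrector of `A`. -/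
def homogenizeCell {d : ℕ} (A : Space d → Matrix (Fin d) (Fin d) ℝ) : Matrix (Fin d) (Fin d) ℝ :=
  Matrix.of fun i j =>
    ∫ z, (A z *ᵥ (EuclideanSpace.single j 1 + correctorGradient A j z).ofLp) i ∂(torusVolume d)

/-- Reiterated homogenization of a coefficient field `K_n(y_1, …, y_n)`: the last (fastest)
variable is homogenized first,
`K_{n-1}(y_1, …, y_{n-1}) = ∫_{𝕋ᵈ} K_n(y_1, …, y_n) (I + ∇_{y_n} θ_nᵀ) dy_n`, and so on down to the
constant matrix `K_0`. Since `θ_k` does not depend on `y_{k+1}, …, y_n`, this is the integral of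
`K_n (I + ∇_{y_n} θ_nᵀ) ⋯ (I + ∇_{y_1} θ_1ᵀ)` over `(𝕋ᵈ)ⁿ`. -/
def reiteratedHomogenize {d : ℕ} :
    (n : ℕ) → ((Fin n → Space d) → Matrix (Fin d) (Fin d) ℝ) → Matrix (Fin d) (Fin d) ℝ
  | 0, K => K Fin.elim0
  | n + 1, K =>
      reiteratedHomogenize n fun y =>
        homogenizeCell fun z => K (Fin.snoc (α := fun _ => Space d) y z)

/-! ### The multiscale potential -/

/-- Standing assumptions on `V(x, y_1, …, y_N) = V₀(x) + V₁(x, y_1, …, y_N)` at temperature `σ`. -/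
structure IsMultiscalePotential {d N : ℕ} (σ : ℝ) (V₀ : Space d → ℝ)
    (V₁ : Space d × (Fin N → Space d) → ℝ) : Prop where
  smooth₀ : ContDiff ℝ ∞ V₀
  integrable₀ : Integrable (fun x => Real.exp (-V₀ x / σ))
  tendsto₀ : Tendsto V₀ (cocompact (Space d)) atTop
  hessian₀ : ∃ C : ℝ, ∀ x, ‖iteratedFDeriv ℝ 2 V₀ x‖ ≤ C
  smooth₁ : ContDiff ℝ ∞ V₁
  bounded₁ : ∃ C : ℝ, ∀ p, |V₁ p| ≤ C
  periodic₁ : ∀ (k : Fin N) (i : Fin d) (x : Space d) (y : Fin N → Space d),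
    V₁ (x, Function.update y k (y k + EuclideanSpace.single i 1)) = V₁ (x, y)

/-- `V^ε(x) = V₀(x) + V₁(x, x/ε, x/ε², …, x/ε^N)`. -/
def multiscalePotential {d N : ℕ} (V₀ : Space d → ℝ) (V₁ : Space d × (Fin N → Space d) → ℝ)
    (ε : ℝ) (x : Space d) : ℝ :=
  V₀ x + V₁ (x, fun k => (ε ^ (k.val + 1))⁻¹ • x)

/-- `osc(F) = sup F - inf F`. -/
def osc {α : Type*} (F : α → ℝ) : ℝ := (⨆ a, F a) - ⨅ a, F a

/-- `Z(x) = ∫_{(𝕋ᵈ)^N} e^{-V(x, y_1, …, y_N)/σ} dy_1 … dy_N`. -/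
def partitionFunction {d N : ℕ} (σ : ℝ) (V₀ : Space d → ℝ)
    (V₁ : Space d × (Fin N → Space d) → ℝ) (x : Space d) : ℝ :=
  ∫ y in {y : Fin N → Space d | ∀ k, y k ∈ unitCell d}, Real.exp (-(V₀ x + V₁ (x, y)) / σ)

/-- The free energy `Ψ(x) = -σ log Z(x)`. -/
def freeEnergy {d N : ℕ} (σ : ℝ) (V₀ : Space d → ℝ)
    (V₁ : Space d × (Fin N → Space d) → ℝ) (x : Space d) : ℝ :=
  -σ * Real.log (partitionFunction σ V₀ V₁ x)

/-- The effective diffusion tensor: `Z(x)⁻¹` times the reiterated homogenization of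
`K_N(x, y_1, …, y_N) = e^{-V(x, y_1, …, y_N)/σ} I`. -/
def effectiveDiffusion {d N : ℕ} (σ : ℝ) (V₀ : Space d → ℝ)
    (V₁ : Space d × (Fin N → Space d) → ℝ) (x : Space d) : Matrix (Fin d) (Fin d) ℝ :=
  (partitionFunction σ V₀ V₁ x)⁻¹ • reiteratedHomogenize N fun y =>
    Real.exp (-(V₀ x + V₁ (x, y)) / σ) • (1 : Matrix (Fin d) (Fin d) ℝ)

/-! ### Gibbs measures, generators and semigroups -/

/-- The Gibbs probability measure with density `e^{-W/σ} / ∫ e^{-W/σ}`. -/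
def gibbs {d : ℕ} (σ : ℝ) (W : Space d → ℝ) : Measure (Space d) :=
  (volume : Measure (Space d)).tilted fun x => -W x / σ

/-- Membership in `C_c^∞(ℝᵈ)`. -/
def IsTestFunction {d : ℕ} (f : Space d → ℝ) : Prop :=
  ContDiff ℝ ∞ f ∧ HasCompactSupport f

/-- The divergence `∑ᵢ ∂ᵢ Fᵢ` of a vector field. -/
def divergence {d : ℕ} (F : Space d → Space d) (x : Space d) : ℝ :=
  ∑ i, fderiv ℝ (fun z => F z i) x (EuclideanSpace.single i 1)

/-- `f ↦ -∇W · ∇f + σ Δf`, the generator of `dX = -∇W(X) dt + √(2σ) dW_t` on `C_c^∞`. -/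
def langevinOperator {d : ℕ} (σ : ℝ) (W f : Space d → ℝ) (x : Space d) : ℝ :=
  -⟪gradient W x, gradient f x⟫_ℝ + σ * Laplacian.laplacian f x

/-- `f ↦ (σ / Z) ∇ · (Z M ∇f)`, the generator of the homogenized dynamics
`dX = -M(X) ∇Ψ(X) dt + σ (∇ · M)(X) dt + √(2σ M(X)) dW_t` on `C_c^∞`. -/
def homogenizedOperator {d N : ℕ} (σ : ℝ) (V₀ : Space d → ℝ)
    (V₁ : Space d × (Fin N → Space d) → ℝ) (f : Space d → ℝ) (x : Space d) : ℝ :=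
  σ / partitionFunction σ V₀ V₁ x *
    divergence (fun z => partitionFunction σ V₀ V₁ z •
      WithLp.toLp 2 (effectiveDiffusion σ V₀ V₁ z *ᵥ (gradient f z).ofLp)) x

/-- The graph in `L²(μ) × L²(μ)` of an operator `L` given on `C_c^∞(ℝᵈ)`. -/
def testGraph {d : ℕ} (μ : Measure (Space d)) (L : (Space d → ℝ) → Space d → ℝ) :
    Set (Lp ℝ 2 μ × Lp ℝ 2 μ) :=
  {p | ∃ f, IsTestFunction f ∧ p.1 =ᵐ[μ] f ∧ p.2 =ᵐ[μ] L f}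

/-- `P` is the strongly continuous semigroup on `L²(μ)` whose infinitesimal generator is the closure
in `L²(μ)` of the operator `L` on `C_c^∞(ℝᵈ)`. There is at most one such `P`. If `L` is symmetric
and nonpositive, the existence of `P` means that `L` is essentially self-adjoint on `C_c^∞(ℝᵈ)`; the
generator of `P` is then the self-adjoint extension of `L`. -/
structure IsDiffusionSemigroup {d : ℕ} (μ : Measure (Space d))
    (L : (Space d → ℝ) → Space d → ℝ) (P : ℝ≥0 → Lp ℝ 2 μ →L[ℝ] Lp ℝ 2 μ) : Prop where
  zero : P 0 = ContinuousLinearMap.id ℝ (Lp ℝ 2 μ)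
  add : ∀ s t, P (s + t) = (P s).comp (P t)
  continuous : ∀ f, Continuous fun t => P t f
  generator :
    {p : Lp ℝ 2 μ × Lp ℝ 2 μ |
      Tendsto (fun t : ℝ≥0 => (t : ℝ)⁻¹ • (P t p.1 - p.1)) (𝓝[>] 0) (𝓝 p.2)} =
      closure (testGraph μ L)

/-- `G` is the weak gradient of `f` on `ℝᵈ`. -/
def IsWeakGradient {d : ℕ} (f : Space d → ℝ) (G : Space d → Space d) : Prop :=
  ∀ φ : Space d → ℝ, IsTestFunction φ → ∀ i : Fin d,
    ∫ x, f x * fderiv ℝ φ x (EuclideanSpace.single i 1) = -∫ x, G x i * φ x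

/-- `Var_μ(f) ≤ C ∫ |∇f|² dμ` for all `f ∈ H¹(μ)`, i.e. all `f ∈ L²(μ)` with weak gradient in
`L²(μ)`. -/
def PoincareInequality {d : ℕ} (μ : Measure (Space d)) (C : ℝ) : Prop :=
  ∀ (f : Space d → ℝ) (G : Space d → Space d), MemLp f 2 μ → MemLp G 2 μ → IsWeakGradient f G →
    Var[f; μ] ≤ C * ∫ x, ‖G x‖ ^ 2 ∂μ

end

/-! The decay rate of the variance is a spectral gap, and a spectral gap changes in a controlled way
when the potential and the diffusion tensor are perturbed by bounded factors. All three generators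
have the form `(σ / w) ∇ · (B ∇f)` on test functions, with `w` an unnormalised Gibbs density.
Integration by parts gives them mean zero and, up to normalising `w`, the energy `-∫ f L f w = σ ∫
∇f · B ∇f`.

Gap implies decay: on the domain of the generator `A`, the variance of `P_t f` has right derivative
`2⟪P_t f, A P_t f⟫`, and a Grönwall argument applies (`varianceForm_le`). It suffices to know the
gap for test functions, because the generator is the closure of `L` on them.

Decay implies gap: differentiating at time `0` gives the gap on the domain of `A`. An arbitrary `f ∈
H¹` with weak gradient `G` is reached without approximating it by test functions. Cauchy-Schwarz
yields `⟪f, A p⟫² ≤ S · (-⟪p, A p⟫)` with `S = σ ∫ |G|²`, first for test functions, then on the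
whole domain by closure. Approximate resolvents `p` of `f` then converge to `f` with energy at most
`S` in the limit (`spectral_gap_of_finite_energy`).

The perturbed rates follow the Holley-Stroock argument (`variance_le_of_perturbation`). Two
potentials whose difference has oscillation at most `osc V₁` have Gibbs measures comparable with
constant `exp (osc V₁ / σ)`. The constant is paid once for the variance and once for the energy,
hence the factor `2` in the exponent. The free energy differs from `V₀` by a quantity between `inf
V₁` and `sup V₁`, so the same comparison applies to it; the lower bound on the effective tensor
costs one more factor, hence the `3`.

That lower bound holds because each cell problem preserves the ellipticity constant: constant fields
are orthogonal to periodic gradients (`le_effectiveForm`). To use it, the chosen correctors must be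
identified with Lax-Milgram solutions, where the Poincaré inequality on the torus enters, and the
homogenized coefficients must be `C¹` in the slow variables for the integration by parts. The latter
follows from smoothness of operator inversion (`contDiff_effectiveForm`). -/

noncomputable section

/-! ### Strongly continuous semigroups on a Hilbert space -/

section Semigroup

variable {H : Type*} [NormedAddCommGroup H] [InnerProductSpace ℝ H]

/-- A strongly continuous semigroup of bounded operators. -/
structure IsStronglyContinuousSemigroup (P : ℝ≥0 → H →L[ℝ] H) : Prop where
  zero : P 0 = ContinuousLinearMap.id ℝ H
  add : ∀ s t, P (s + t) = (P s).comp (P t)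
  continuous : ∀ f, Continuous fun t => P t f

/-- The graph of the infinitesimal generator. -/
def generatorGraph (P : ℝ≥0 → H →L[ℝ] H) : Submodule ℝ (H × H) where
  carrier := {p | Tendsto (fun t : ℝ≥0 => (t : ℝ)⁻¹ • (P t p.1 - p.1)) (𝓝[>] 0) (𝓝 p.2)}
  add_mem' {p q} hp hq := by
    simp only [Set.mem_ofPred_eq] at hp hq ⊢
    refine (hp.add hq).congr fun t => ?_
    simp only [Prod.fst_add, map_add, ← smul_add]
    congr 1; abel
  zero_mem' := by simp
  smul_mem' c p hp := by
    simp only [Set.mem_ofPred_eq] at hp ⊢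
    refine (hp.const_smul c).congr fun t => ?_
    simp only [Prod.smul_fst, map_smul, ← smul_sub]
    rw [smul_comm]

lemma mem_generatorGraph {P : ℝ≥0 → H →L[ℝ] H} {p : H × H} :
    p ∈ generatorGraph P ↔
      Tendsto (fun t : ℝ≥0 => (t : ℝ)⁻¹ • (P t p.1 - p.1)) (𝓝[>] 0) (𝓝 p.2) := Iff.rfl

/-- The quadratic form `‖x‖² - ⟪e, x⟫²`; for the constant function `e = 1` it is the variance. -/
def varianceForm (e x : H) : ℝ := ‖x‖ ^ 2 - ⟪e, x⟫_ℝ ^ 2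

@[fun_prop]
lemma continuous_varianceForm (e : H) : Continuous (varianceForm e) := by
  unfold varianceForm; fun_prop

namespace IsStronglyContinuousSemigroup

variable {P : ℝ≥0 → H →L[ℝ] H} (hP : IsStronglyContinuousSemigroup P)
include hP

/-- The difference quotients commute with `P t`, so the domain is invariant and the generator
commutes with the semigroup. -/
lemma map_mem_generatorGraph {p : H × H} (hp : p ∈ generatorGraph P) (t : ℝ≥0) :
    (P t p.1, P t p.2) ∈ generatorGraph P := by
  rw [mem_generatorGraph] at hp ⊢
  refine (((P t).continuous.tendsto _).comp hp).congr fun s => ?_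
  have h : P t (P s p.1) = P s (P t p.1) := by
    rw [← ContinuousLinearMap.comp_apply, ← hP.add, add_comm, hP.add]; rfl
  simp [h]

/-- The semigroup law turns the slope at `t` into the slope at `0` along the orbit. A right
derivative is enough for the comparison arguments below. -/
lemma hasDerivWithinAt {p : H × H} (hp : p ∈ generatorGraph P) {t : ℝ} (ht : 0 ≤ t) :
    HasDerivWithinAt (fun s : ℝ => P s.toNNReal p.1) (P t.toNNReal p.2) (Set.Ici t) t := by
  rw [hasDerivWithinAt_iff_tendsto_slope, Set.Ici_sdiff_left]
  have h1 : Tendsto (fun s : ℝ => (s - t).toNNReal) (𝓝[>] t) (𝓝[>] 0) := by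
    refine tendsto_nhdsWithin_iff.2 ⟨?_, ?_⟩
    · have : Continuous fun s : ℝ => (s - t).toNNReal := by fun_prop
      simpa using (this.tendsto t).mono_left nhdsWithin_le_nhds
    · filter_upwards [self_mem_nhdsWithin] with s hs
      simpa using hs
  refine ((hP.map_mem_generatorGraph hp t.toNNReal).comp h1).congr' ?_
  filter_upwards [self_mem_nhdsWithin] with s hs
  have hs : t < s := hs
  have h2 : s.toNNReal = (s - t).toNNReal + t.toNNReal := by
    rw [← Real.toNNReal_add (by linarith) ht, sub_add_cancel]
  simp only [Function.comp, slope, vsub_eq_sub, h2, hP.add, ContinuousLinearMap.comp_apply]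
  rw [Real.coe_toNNReal _ (by linarith)]

lemma continuous_real (x : H) : Continuous fun s : ℝ => P s.toNNReal x :=
  (hP.continuous x).comp continuous_real_toNNReal

/-- A spectral gap inequality on the domain of the generator gives exponential decay. -/
theorem varianceForm_le_of_mem {e : H} {c : ℝ}
    (h0 : ∀ p ∈ generatorGraph P, ⟪e, p.2⟫_ℝ = 0)
    (hc : ∀ p ∈ generatorGraph P, c * varianceForm e p.1 ≤ -⟪p.1, p.2⟫_ℝ)
    {p : H × H} (hp : p ∈ generatorGraph P) (t : ℝ≥0) :
    varianceForm e (P t p.1) ≤ Real.exp (-2 * c * t) * varianceForm e p.1 := by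
  have key := image_le_of_deriv_right_le_deriv_boundary (a := 0) (b := (t : ℝ))
    (f := fun s : ℝ => Real.exp (2 * c * s) * varianceForm e (P s.toNNReal p.1))
    (f' := fun s : ℝ => 2 * c * Real.exp (2 * c * s) * varianceForm e (P s.toNNReal p.1) +
      Real.exp (2 * c * s) * (2 * ⟪P s.toNNReal p.1, P s.toNNReal p.2⟫_ℝ))
    (B := fun _ => varianceForm e p.1) (B' := 0) ?_ ?_ ?_ ?_ ?_ ?_
  · have := key (x := (t : ℝ)) ⟨t.2, le_rfl⟩
    simp only [Real.toNNReal_coe] at this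
    rw [show -2 * c * (t : ℝ) = -(2 * c * t) by ring, Real.exp_neg]
    rwa [← div_eq_inv_mul, le_div_iff₀' (Real.exp_pos _)]
  · have h1 := (continuous_varianceForm e).comp (hP.continuous_real p.1)
    have h2 : Continuous fun s : ℝ => Real.exp (2 * c * s) := by fun_prop
    exact (h2.mul h1).continuousOn
  · intro s hs
    have hd := hP.hasDerivWithinAt hp hs.1
    have h2 : ⟪e, P s.toNNReal p.2⟫_ℝ = 0 := h0 _ (hP.map_mem_generatorGraph hp _)
    -- The component along `e` is conserved by `h2`, so only the norm contributes to the derivative.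
    have h3 : HasDerivWithinAt (fun s : ℝ => varianceForm e (P s.toNNReal p.1))
        (2 * ⟪P s.toNNReal p.1, P s.toNNReal p.2⟫_ℝ) (Set.Ici s) s := by
      have h4 := hd.norm_sq
      have h5 := ((hasDerivWithinAt_const s (Set.Ici s) e).inner ℝ hd).pow 2
      refine (h4.sub h5).congr_deriv ?_
      simp [h2]
    have h6 : HasDerivWithinAt (fun s : ℝ => Real.exp (2 * c * s))
        (2 * c * Real.exp (2 * c * s)) (Set.Ici s) s := by
      have := ((hasDerivAt_id s).const_mul (2 * c)).exp.hasDerivWithinAt (s := Set.Ici s)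
      refine this.congr_deriv ?_
      simp; ring
    exact h6.mul h3
  · simp [hP.zero]
  · exact continuousOn_const
  · intro s _; exact hasDerivWithinAt_const _ _ _
  · intro s hs
    have h1 := hc _ (hP.map_mem_generatorGraph hp s.toNNReal)
    have h2 := Real.exp_pos (2 * c * s)
    simp only [Pi.zero_apply] at *
    nlinarith

theorem varianceForm_le {e : H} {c : ℝ} (hdense : Dense (Prod.fst '' (generatorGraph P : Set (H × H))))
    (h0 : ∀ p ∈ generatorGraph P, ⟪e, p.2⟫_ℝ = 0)
    (hc : ∀ p ∈ generatorGraph P, c * varianceForm e p.1 ≤ -⟪p.1, p.2⟫_ℝ) (x : H) (t : ℝ≥0) :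
    varianceForm e (P t x) ≤ Real.exp (-2 * c * t) * varianceForm e x := by
  refine hdense.induction (P := fun x => varianceForm e (P t x) ≤
    Real.exp (-2 * c * t) * varianceForm e x) ?_ (isClosed_le (by fun_prop) (by fun_prop)) x
  rintro _ ⟨p, hp, rfl⟩
  exact hP.varianceForm_le_of_mem h0 hc hp t

theorem norm_map_le (hdense : Dense (Prod.fst '' (generatorGraph P : Set (H × H))))
    (hc : ∀ p ∈ generatorGraph P, 0 ≤ -⟪p.1, p.2⟫_ℝ) (x : H) (t : ℝ≥0) : ‖P t x‖ ≤ ‖x‖ := by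
  have := hP.varianceForm_le (e := 0) (c := 0) hdense (by simp) (by simpa using hc) x t
  simp only [varianceForm, inner_zero_left] at this
  norm_num at this
  exact (sq_le_sq₀ (norm_nonneg _) (norm_nonneg _)).1 this

/-- Exponential decay gives a spectral gap inequality on the domain of the generator. -/
theorem spectral_gap_of_decay {e : H} {c : ℝ}
    (h0 : ∀ p ∈ generatorGraph P, ⟪e, p.2⟫_ℝ = 0)
    {p : H × H} (hp : p ∈ generatorGraph P)
    (hdecay : ∀ t : ℝ≥0, varianceForm e (P t p.1) ≤ Real.exp (-2 * c * t) * varianceForm e p.1) :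
    c * varianceForm e p.1 ≤ -⟪p.1, p.2⟫_ℝ := by
  have hd := hP.hasDerivWithinAt hp le_rfl
  have hz : P (Real.toNNReal 0) = ContinuousLinearMap.id ℝ H := by simp [hP.zero]
  -- This function vanishes at `0` and is nonpositive afterwards, so its right derivative at `0` is
  -- nonpositive.
  have h3 : HasDerivWithinAt (fun s : ℝ => varianceForm e (P s.toNNReal p.1)
        - Real.exp (-2 * c * s) * varianceForm e p.1)
      (2 * ⟪p.1, p.2⟫_ℝ + 2 * c * varianceForm e p.1) (Set.Ici 0) 0 := by
    have h4 := hd.norm_sq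
    have h5 := ((hasDerivWithinAt_const 0 (Set.Ici 0) e).inner ℝ hd).pow 2
    have h6 := (((hasDerivAt_id (0 : ℝ)).const_mul (-2 * c)).exp.mul_const
      (varianceForm e p.1)).hasDerivWithinAt (s := Set.Ici 0)
    refine ((h4.sub h5).sub h6).congr_deriv ?_
    simp only [hz, ContinuousLinearMap.id_apply, h0 _ hp, inner_zero_left, add_zero, mul_zero, id,
      Real.exp_zero]
    ring
  have h7 : 2 * ⟪p.1, p.2⟫_ℝ + 2 * c * varianceForm e p.1 ≤ 0 := by
    have h8 := hasDerivWithinAt_iff_tendsto_slope.1 h3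
    rw [Set.Ici_sdiff_left] at h8
    refine le_of_tendsto h8 ?_
    filter_upwards [self_mem_nhdsWithin] with s hs
    have hs : 0 < s := hs
    simp only [slope, vsub_eq_sub, hz, smul_eq_mul]
    have := hdecay s.toNNReal
    rw [Real.coe_toNNReal _ hs.le] at this
    refine mul_nonpos_of_nonneg_of_nonpos (by simp [hs.le]) ?_
    simp only [ContinuousLinearMap.id_apply, mul_zero, Real.exp_zero, one_mul]
    linarith
  linarith

/-! ### Approximate resolvents and vectors of finite energy -/

variable [CompleteSpace H]

/-- The range of `1 - δA` is dense for a dissipative generator `A`. -/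
lemma dense_range_sub (hdense : Dense (Prod.fst '' (generatorGraph P : Set (H × H))))
    (hc : ∀ p ∈ generatorGraph P, 0 ≤ -⟪p.1, p.2⟫_ℝ) {δ : ℝ} (hδ : 0 < δ) :
    Dense ((fun p : H × H => p.1 - δ • p.2) '' (generatorGraph P : Set (H × H))) := by
  set R : Submodule ℝ H := (generatorGraph P).map
    (LinearMap.fst ℝ H H - δ • LinearMap.snd ℝ H H) with hR
  have hRS : ((fun p : H × H => p.1 - δ • p.2) '' (generatorGraph P : Set (H × H))) = R := by
    ext; simp [hR]
  rw [hRS, Submodule.dense_iff_topologicalClosure_eq_top, Submodule.topologicalClosure_eq_top_iff,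
    Submodule.eq_bot_iff]
  intro h hh
  -- A vector orthogonal to the range satisfies `A* h = δ⁻¹ h` weakly. Then `⟪h, P_t p⟫` grows like
  -- `exp (t / δ)`, which contractivity forbids unless it is zero.
  have hperp : ∀ p ∈ generatorGraph P, ⟪h, p.2⟫_ℝ = δ⁻¹ * ⟪h, p.1⟫_ℝ := by
    intro p hp
    have h1 : p.1 - δ • p.2 ∈ R := by rw [← SetLike.mem_coe, ← hRS]; exact ⟨p, hp, rfl⟩
    have h2 := Submodule.mem_orthogonal' R h |>.1 hh _ h1
    rw [inner_sub_right, inner_smul_right] at h2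
    field_simp
    linarith
  have hzero : ∀ p ∈ generatorGraph P, ⟪h, p.1⟫_ℝ = 0 := by
    intro p hp
    have hconst : ∀ t : ℝ, 0 ≤ t →
        Real.exp (-(δ⁻¹ * t)) * ⟪h, P t.toNNReal p.1⟫_ℝ = ⟪h, p.1⟫_ℝ := by
      intro t ht
      have := constant_of_has_deriv_right_zero (a := 0) (b := t)
        (f := fun s : ℝ => Real.exp (-(δ⁻¹ * s)) * ⟪h, P s.toNNReal p.1⟫_ℝ) ?_ ?_ t ⟨ht, le_rfl⟩
      · simpa [hP.zero] using this
      · have h1 := (continuous_const (y := h)).inner (𝕜 := ℝ) (hP.continuous_real p.1)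
        have h2 : Continuous fun s : ℝ => Real.exp (-(δ⁻¹ * s)) := by fun_prop
        exact (h2.mul h1).continuousOn
      · intro s hs
        have hd := (hasDerivWithinAt_const s (Set.Ici s) h).inner ℝ (hP.hasDerivWithinAt hp hs.1)
        have he := ((hasDerivAt_id s).const_mul δ⁻¹).neg.exp.hasDerivWithinAt (s := Set.Ici s)
        refine (he.mul hd).congr_deriv ?_
        have := hperp _ (hP.map_mem_generatorGraph hp s.toNNReal)
        simp only at this
        simp only [this, inner_zero_left, id]
        ring
    have hbound : ∀ t : ℝ, 0 ≤ t → |⟪h, p.1⟫_ℝ| ≤ Real.exp (-(δ⁻¹ * t)) * (‖h‖ * ‖p.1‖) := by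
      intro t ht
      rw [← hconst t ht, abs_mul, abs_of_pos (Real.exp_pos _)]
      gcongr
      refine (abs_real_inner_le_norm _ _).trans ?_
      gcongr
      exact hP.norm_map_le hdense hc _ _
    have hlim : Tendsto (fun t : ℝ => Real.exp (-(δ⁻¹ * t)) * (‖h‖ * ‖p.1‖)) atTop (𝓝 0) := by
      have := (Real.tendsto_exp_neg_atTop_nhds_zero.comp
        (tendsto_id.const_mul_atTop (inv_pos.2 hδ))).mul_const (‖h‖ * ‖p.1‖)
      simpa [Function.comp_def] using this
    have := ge_of_tendsto hlim ((eventually_ge_atTop 0).mono hbound)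
    exact abs_nonpos_iff.1 this
  have hall : ∀ x : H, ⟪h, x⟫_ℝ = 0 := by
    intro x
    refine hdense.induction (P := fun x => ⟪h, x⟫_ℝ = 0) ?_
      (isClosed_eq (by fun_prop) continuous_const) x
    rintro _ ⟨p, hp, rfl⟩
    exact hzero p hp
  exact inner_self_eq_zero.1 (hall h)

omit [CompleteSpace H] hP in
lemma norm_le_norm_sub_smul {x y : H} (h : 0 ≤ -⟪x, y⟫_ℝ) {δ : ℝ} (hδ : 0 ≤ δ) :
    ‖x‖ ≤ ‖x - δ • y‖ := by
  refine (sq_le_sq₀ (norm_nonneg _) (norm_nonneg _)).1 ?_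
  rw [norm_sub_sq_real, inner_smul_right]
  nlinarith [sq_nonneg ‖δ • y‖]

/-- The approximant is an approximate solution of `(1 - δA) p = f`. Pairing this equation with `A p`
gives `-⟪p, A p⟫ = -⟪f, A p⟫ - δ‖A p‖²` up to the residual, whose effect is absorbed by the last
term. -/
lemma exists_approx (hdense : Dense (Prod.fst '' (generatorGraph P : Set (H × H))))
    (hc : ∀ p ∈ generatorGraph P, 0 ≤ -⟪p.1, p.2⟫_ℝ) (f : H) {η : ℝ} (hη : 0 < η) :
    ∃ p ∈ generatorGraph P, ‖p.1 - f‖ ≤ η ∧ -⟪p.1, p.2⟫_ℝ ≤ -⟪f, p.2⟫_ℝ + η := by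
  obtain ⟨_, ⟨q, hq, rfl⟩, hqf⟩ := hdense.exists_dist_lt f (show 0 < η / 4 by positivity)
  -- The auxiliary `q` in the domain is close to `f`; for small `δ` the operator `1 - δA` barely
  -- moves it, which forces `p` close to `f`.
  obtain ⟨δ, hδ, hδη, hδq⟩ : ∃ δ : ℝ, 0 < δ ∧ δ ≤ η / 4 ∧ δ * ‖q.2‖ ≤ η / 4 := by
    refine ⟨η / 4 / (1 + ‖q.2‖), by positivity, ?_, ?_⟩
    · exact div_le_self (by positivity) (by linarith [norm_nonneg q.2])
    · rw [div_mul_eq_mul_div, div_le_iff₀ (by positivity)]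
      nlinarith [norm_nonneg q.2]
  -- The tolerance is `δ` itself: the residual contributes at most `δ‖A p‖ ≤ δ‖A p‖² + δ / 4`.
  obtain ⟨_, ⟨p, hp, rfl⟩, hpf⟩ := (hP.dense_range_sub hdense hc hδ).exists_dist_lt f hδ
  rw [dist_eq_norm] at hqf hpf
  simp only at hpf
  refine ⟨p, hp, ?_, ?_⟩
  · have h1 := norm_le_norm_sub_smul (hc _ (sub_mem hp hq)) hδ.le
    simp only [Prod.fst_sub, Prod.snd_sub] at h1
    have h2 : p.1 - q.1 - δ • (p.2 - q.2) = -(f - (p.1 - δ • p.2)) + (f - q.1) + δ • q.2 := by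
      rw [smul_sub]; abel
    rw [h2] at h1
    have h3 := norm_add₃_le (a := -(f - (p.1 - δ • p.2))) (b := f - q.1) (c := δ • q.2)
    rw [norm_neg, norm_smul, Real.norm_of_nonneg hδ.le] at h3
    have h4 : p.1 - f = (p.1 - q.1) + -(f - q.1) := by abel
    rw [h4]
    refine (norm_add_le _ _).trans ?_
    rw [norm_neg]
    linarith
  · set r := f - (p.1 - δ • p.2) with hr
    have h1 : f = r + p.1 - δ • p.2 := by rw [hr]; abel
    have h2 : -⟪f, p.2⟫_ℝ = -⟪r, p.2⟫_ℝ - ⟪p.1, p.2⟫_ℝ + δ * ‖p.2‖ ^ 2 := by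
      rw [h1, inner_sub_left, inner_add_left, inner_smul_left, real_inner_self_eq_norm_sq]
      simp; ring
    have h3 : ⟪r, p.2⟫_ℝ ≤ δ * ‖p.2‖ :=
      (real_inner_le_norm _ _).trans (by gcongr)
    nlinarith [mul_nonneg hδ.le (sq_nonneg (‖p.2‖ - 1 / 2))]

/-- If the spectral gap inequality holds on the domain of the generator, and `x` has finite energy
`S`, then the spectral gap inequality holds for `x`. -/
theorem spectral_gap_of_finite_energy {e : H} {c S : ℝ}
    (hdense : Dense (Prod.fst '' (generatorGraph P : Set (H × H))))
    (hc0 : ∀ p ∈ generatorGraph P, 0 ≤ -⟪p.1, p.2⟫_ℝ)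
    (hc : ∀ p ∈ generatorGraph P, c * varianceForm e p.1 ≤ -⟪p.1, p.2⟫_ℝ) (hS : 0 ≤ S) {x : H}
    (hx : ∀ p ∈ generatorGraph P, ⟪x, p.2⟫_ℝ ^ 2 ≤ S * -⟪p.1, p.2⟫_ℝ) :
    c * varianceForm e x ≤ S := by
  have hpos : ∀ n : ℕ, (0 : ℝ) < 1 / ((n : ℝ) + 1) := fun n => by positivity
  choose p hp hpx hpE using fun n : ℕ => hP.exists_approx hdense hc0 x (hpos n)
  have hlim : Tendsto (fun n => (p n).1) atTop (𝓝 x) := by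
    rw [tendsto_iff_norm_sub_tendsto_zero]
    exact squeeze_zero (fun n => norm_nonneg _) hpx tendsto_one_div_add_atTop_nhds_zero_nat
  have hbound : ∀ n, c * varianceForm e (p n).1 ≤ S + 2 * (1 / ((n : ℝ) + 1)) := by
    intro n
    refine (hc _ (hp n)).trans ?_
    have h1 := hpE n
    have h2 := hx _ (hp n)
    have h3 := hc0 _ (hp n)
    -- By the arithmetic-geometric mean inequality. Half of the energy of `p n` is then absorbed on
    -- the left, leaving the bound `S` plus an error.
    have h4 : -⟪x, (p n).2⟫_ℝ ≤ (S + -⟪(p n).1, (p n).2⟫_ℝ) / 2 := by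
      refine abs_le_of_sq_le_sq' ?_ (by positivity) |>.2
      nlinarith [sq_nonneg (S - -⟪(p n).1, (p n).2⟫_ℝ)]
    linarith
  have h1 : Tendsto (fun n => c * varianceForm e (p n).1) atTop (𝓝 (c * varianceForm e x)) :=
    (((continuous_varianceForm e).tendsto x).comp hlim).const_mul c
  have h2 : Tendsto (fun n : ℕ => S + 2 * (1 / ((n : ℝ) + 1))) atTop (𝓝 (S + 2 * 0)) :=
    (tendsto_one_div_add_atTop_nhds_zero_nat.const_mul 2).const_add S
  simpa using le_of_tendsto_of_tendsto' h1 h2 hbound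

end IsStronglyContinuousSemigroup

end Semigroup

/-! ### Gradients and integration by parts on `ℝᵈ` -/

section Calculus

variable {d : ℕ}

lemma inner_gradient_eq_fderiv (g : Space d → ℝ) (x v : Space d) :
    ⟪gradient g x, v⟫_ℝ = fderiv ℝ g x v := by
  rw [← toDual_gradient, InnerProductSpace.toDual_apply_apply]

lemma gradient_apply (g : Space d → ℝ) (x : Space d) (i : Fin d) :
    gradient g x i = fderiv ℝ g x (EuclideanSpace.single i 1) := by
  have h := inner_gradient_eq_fderiv g x (EuclideanSpace.single i 1)
  rw [EuclideanSpace.inner_single_right] at h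
  simpa using h

lemma real_inner_eq_sum (v w : Space d) : ⟪v, w⟫_ℝ = ∑ i, v i * w i := by
  simp [PiLp.inner_apply, mul_comm]

lemma ContDiff.gradient {g : Space d → ℝ} {n m : WithTop ℕ∞} (hg : ContDiff ℝ n g)
    (hmn : m + 1 ≤ n) : ContDiff ℝ m (gradient g) :=
  (InnerProductSpace.toDual ℝ (Space d)).symm.contDiff.comp (hg.fderiv_right hmn)

lemma HasCompactSupport.gradient {g : Space d → ℝ} (hg : HasCompactSupport g) :
    HasCompactSupport (gradient g) :=
  (hg.fderiv ℝ).comp_left (g := (InnerProductSpace.toDual ℝ (Space d)).symm) (map_zero _)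

lemma IsTestFunction.continuous {f : Space d → ℝ} (hf : IsTestFunction f) : Continuous f :=
  hf.1.continuous

lemma IsTestFunction.contDiff_one {f : Space d → ℝ} (hf : IsTestFunction f) : ContDiff ℝ 1 f :=
  hf.1.of_le (by simp)

lemma IsTestFunction.continuous_gradient {f : Space d → ℝ} (hf : IsTestFunction f) :
    Continuous (gradient f) :=
  (hf.1.gradient (m := 0) (by simp)).continuous

lemma contDiff_coord {n : WithTop ℕ∞} {F : Space d → Space d} (hF : ContDiff ℝ n F) (i : Fin d) :
    ContDiff ℝ n fun x => F x i :=
  (contDiff_euclidean.1 hF) i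

lemma hasCompactSupport_coord {F : Space d → Space d} (hF : HasCompactSupport F) (i : Fin d) :
    HasCompactSupport fun x => F x i :=
  hF.comp_left (g := fun v : Space d => v i) rfl

lemma continuous_fderiv_coord {F : Space d → Space d} (hF : ContDiff ℝ 1 F) (i : Fin d)
    (v : Space d) : Continuous fun x => fderiv ℝ (fun z => F z i) x v :=
  ((contDiff_coord hF i).continuous_fderiv one_ne_zero).clm_apply continuous_const

lemma hasCompactSupport_fderiv_coord {F : Space d → Space d} (hF : HasCompactSupport F) (i : Fin d)
    (v : Space d) : HasCompactSupport fun x => fderiv ℝ (fun z => F z i) x v :=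
  (hasCompactSupport_coord hF i).fderiv_apply ℝ v

lemma continuous_divergence {F : Space d → Space d} (hF : ContDiff ℝ 1 F) :
    Continuous (divergence F) :=
  continuous_finsetSum _ fun i _ => continuous_fderiv_coord hF i _

lemma hasCompactSupport_divergence {F : Space d → Space d} (hF : HasCompactSupport F) :
    HasCompactSupport (divergence F) := by
  refine HasCompactSupport.of_support_subset_isCompact hF ?_
  intro x hx
  by_contra hx'
  refine hx (Finset.sum_eq_zero fun i _ => ?_)
  have h := image_eq_zero_of_notMem_tsupport (f := fun x => fderiv ℝ (fun z => F z i) x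
    (EuclideanSpace.single i 1)) (x := x)
  refine h fun h2 => hx' ?_
  have h3 : tsupport (fun x => F x i) ⊆ tsupport F :=
    closure_mono fun y hy hy' => hy (by simp [hy'])
  exact h3 (tsupport_fderiv_apply_subset ℝ _ h2)

theorem integral_mul_divergence {g : Space d → ℝ} {F : Space d → Space d} (hg : ContDiff ℝ 1 g)
    (hF : ContDiff ℝ 1 F) (hFc : HasCompactSupport F) :
    ∫ x, g x * divergence F x = -∫ x, ⟪gradient g x, F x⟫_ℝ := by
  have hg' : ∀ v, Continuous fun x => fderiv ℝ g x v := fun v =>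
    (hg.continuous_fderiv one_ne_zero).clm_apply continuous_const
  have h1 : ∀ i, Integrable fun x => g x * fderiv ℝ (fun z => F z i) x
      (EuclideanSpace.single i 1) := fun i =>
    (hg.continuous.mul (continuous_fderiv_coord hF i _)).integrable_of_hasCompactSupport
      (hasCompactSupport_fderiv_coord hFc i _).mul_left
  have h2 : ∀ i, Integrable fun x => fderiv ℝ g x (EuclideanSpace.single i 1) * F x i := fun i =>
    ((hg' _).mul (contDiff_coord hF i).continuous).integrable_of_hasCompactSupport
      (hasCompactSupport_coord hFc i).mul_left
  have h3 : ∀ i, Integrable fun x => g x * F x i := fun i =>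
    (hg.continuous.mul (contDiff_coord hF i).continuous).integrable_of_hasCompactSupport
      (hasCompactSupport_coord hFc i).mul_left
  simp only [divergence, Finset.mul_sum, real_inner_eq_sum, gradient_apply]
  rw [integral_finsetSum _ fun i _ => h1 i, integral_finsetSum _ fun i _ => h2 i,
    ← Finset.sum_neg_distrib]
  refine Finset.sum_congr rfl fun i _ => ?_
  exact integral_mul_fderiv_eq_neg_fderiv_mul_of_integrable (h2 i) (h1 i) (h3 i)
    (fun x _ => (hg.differentiable one_ne_zero) x)
    (fun x _ => ((contDiff_coord hF i).differentiable one_ne_zero) x)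

/-- Each coordinate of `F` is itself a test function for the weak gradient. -/
theorem IsWeakGradient.integral_mul_divergence {f : Space d → ℝ} {G F : Space d → Space d}
    (h : IsWeakGradient f G) (hf : LocallyIntegrable f) (hG : LocallyIntegrable G)
    (hF : ContDiff ℝ ∞ F) (hFc : HasCompactSupport F) :
    ∫ x, f x * divergence F x = -∫ x, ⟪G x, F x⟫_ℝ := by
  have h1 : ∀ i, Integrable fun x => f x * fderiv ℝ (fun z => F z i) x
      (EuclideanSpace.single i 1) := fun i => by
    simpa only [smul_eq_mul] using hf.integrable_smul_right_of_hasCompactSupport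
      (continuous_fderiv_coord (hF.of_le (by simp)) i _) (hasCompactSupport_fderiv_coord hFc i _)
  have h2 : ∀ i, Integrable fun x => G x i * F x i := fun i => by
    have h3 := hG.integrable_smul_left_of_hasCompactSupport
      (contDiff_coord hF i).continuous (hasCompactSupport_coord hFc i)
    have h4 := (EuclideanSpace.proj (𝕜 := ℝ) i).integrable_comp h3
    refine h4.congr (Eventually.of_forall fun x => ?_)
    simp [mul_comm]
  simp only [divergence, Finset.mul_sum, real_inner_eq_sum]
  rw [integral_finsetSum _ fun i _ => h1 i, integral_finsetSum _ fun i _ => h2 i,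
    ← Finset.sum_neg_distrib]
  refine Finset.sum_congr rfl fun i _ => ?_
  exact h _ ⟨contDiff_coord hF i, hasCompactSupport_coord hFc i⟩ i

lemma IsTestFunction.isWeakGradient {f : Space d → ℝ} (hf : IsTestFunction f) :
    IsWeakGradient f (gradient f) := by
  intro φ hφ i
  simp only [gradient_apply]
  have hc : ∀ {g : Space d → ℝ}, IsTestFunction g →
      Continuous fun x => fderiv ℝ g x (EuclideanSpace.single i 1) := fun hg =>
    (hg.contDiff_one.continuous_fderiv one_ne_zero).clm_apply continuous_const
  refine integral_mul_fderiv_eq_neg_fderiv_mul_of_integrable ?_ ?_ ?_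
    (fun x _ => (hf.contDiff_one.differentiable one_ne_zero) x)
    (fun x _ => (hφ.contDiff_one.differentiable one_ne_zero) x)
  · exact ((hc hf).mul hφ.continuous).integrable_of_hasCompactSupport hφ.2.mul_left
  · exact (hf.continuous.mul (hc hφ)).integrable_of_hasCompactSupport hf.2.mul_right
  · exact (hf.continuous.mul hφ.continuous).integrable_of_hasCompactSupport hf.2.mul_right

/-! ### Operators in divergence form -/

/-- The operator `f ↦ (σ / w) ∇ · (B ∇f)`. -/
def divergenceFormOperator (σ : ℝ) (w : Space d → ℝ) (B : Space d → Matrix (Fin d) (Fin d) ℝ)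
    (f : Space d → ℝ) (x : Space d) : ℝ :=
  σ / w x * divergence (fun z => WithLp.toLp 2 (B z *ᵥ (gradient f z).ofLp)) x

lemma laplacian_eq_sum_fderiv {f : Space d → ℝ} (hf : ContDiff ℝ 2 f) (x : Space d) :
    Laplacian.laplacian f x = ∑ i, fderiv ℝ (fun z => fderiv ℝ f z (EuclideanSpace.single i 1)) x
      (EuclideanSpace.single i 1) := by
  rw [InnerProductSpace.laplacian_eq_iteratedFDeriv_orthonormalBasis f
    (EuclideanSpace.basisFun (Fin d) ℝ)]
  refine Finset.sum_congr rfl fun i _ => ?_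
  have hd : DifferentiableAt ℝ (fderiv ℝ f) x :=
    (hf.fderiv_right (m := 1) (by norm_num)).differentiable one_ne_zero x
  rw [iteratedFDeriv_two_apply, fderiv_clm_apply hd (differentiableAt_const _)]
  simp

/-- Product rule: differentiating the weight `exp (-W / σ)` produces the drift. -/
lemma langevinOperator_eq_divergenceFormOperator {σ : ℝ} (hσ : σ ≠ 0) {W f : Space d → ℝ}
    (hW : ContDiff ℝ 1 W) (hf : ContDiff ℝ 2 f) :
    langevinOperator σ W f = divergenceFormOperator σ (fun x => Real.exp (-W x / σ))
      (fun x => Real.exp (-W x / σ) • 1) f := by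
  ext x
  have hcoord : ∀ i, (fun z => (WithLp.toLp 2 ((Real.exp (-W z / σ) •
      (1 : Matrix (Fin d) (Fin d) ℝ)) *ᵥ (gradient f z).ofLp) : Space d) i) =
      fun z => Real.exp (-W z / σ) * fderiv ℝ f z (EuclideanSpace.single i 1) := by
    intro i
    ext z
    simp [Matrix.smul_mulVec, gradient_apply]
  have hdW : DifferentiableAt ℝ W x := hW.differentiable one_ne_zero x
  have hdw : HasFDerivAt (fun z => Real.exp (-W z / σ))
      (Real.exp (-W x / σ) • (-(σ⁻¹) • fderiv ℝ W x)) x := by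
    have h1 := (hdW.hasFDerivAt.const_mul (-(σ⁻¹))).exp
    have h2 : ∀ z, -W z / σ = -(σ⁻¹) * W z := fun z => by field_simp
    simp only [h2]
    exact h1
  have hdf : ∀ i : Fin d, DifferentiableAt ℝ
      (fun z => fderiv ℝ f z (EuclideanSpace.single i 1)) x := fun i =>
    ((hf.fderiv_right (m := 1) (by norm_num)).differentiable one_ne_zero x).clm_apply
      (differentiableAt_const _)
  have hpos := Real.exp_pos (-W x / σ)
  rw [langevinOperator, divergenceFormOperator, divergence, laplacian_eq_sum_fderiv hf,
    real_inner_eq_sum, Finset.mul_sum, Finset.mul_sum, ← Finset.sum_neg_distrib,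
    ← Finset.sum_add_distrib]
  refine Finset.sum_congr rfl fun i _ => ?_
  rw [hcoord, (hdw.fun_mul (hdf i).hasFDerivAt).fderiv]
  simp only [gradient_apply, add_apply, smul_apply,
    smul_eq_mul]
  field_simp
  ring

variable {B : Space d → Matrix (Fin d) (Fin d) ℝ} {f : Space d → ℝ}

lemma contDiff_flux {n : WithTop ℕ∞} (hB : ∀ i j, ContDiff ℝ n fun x => B x i j)
    (hf : ContDiff ℝ (n + 1) f) :
    ContDiff ℝ n fun z => (WithLp.toLp 2 (B z *ᵥ (gradient f z).ofLp) : Space d) := by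
  rw [contDiff_euclidean]
  intro i
  simp only [Matrix.mulVec, dotProduct]
  exact ContDiff.sum fun j _ => (hB i j).mul (contDiff_coord (hf.gradient le_rfl) j)

lemma IsTestFunction.contDiff_flux (hB : ∀ i j, ContDiff ℝ 1 fun x => B x i j)
    (hf : IsTestFunction f) :
    ContDiff ℝ 1 fun z => (WithLp.toLp 2 (B z *ᵥ (gradient f z).ofLp) : Space d) :=
  _root_.contDiff_flux hB (hf.1.of_le (by rw [one_add_one_eq_two]; exact ENat.LEInfty.out))

lemma hasCompactSupport_flux (hf : HasCompactSupport f) :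
    HasCompactSupport fun z => (WithLp.toLp 2 (B z *ᵥ (gradient f z).ofLp) : Space d) := by
  refine hf.gradient.mono' fun x hx => subset_tsupport _ fun h => hx ?_
  simp [h]

end Calculus

/-! ### Decay of diffusion semigroups -/

section Diffusion

variable {d : ℕ} {μ : Measure (Space d)}

lemma inner_toLp_toLp {f g : Space d → ℝ} (hf : MemLp f 2 μ) (hg : MemLp g 2 μ) :
    ⟪hf.toLp f, hg.toLp g⟫_ℝ = ∫ x, f x * g x ∂μ := by
  rw [L2.inner_def]
  refine integral_congr_ae ?_
  filter_upwards [hf.coeFn_toLp, hg.coeFn_toLp] with x h1 h2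
  rw [h1, h2]
  simp [mul_comm]

variable [IsProbabilityMeasure μ]

variable (μ) in
/-- The constant function `1` in `L²(μ)`. -/
def oneLp : Lp ℝ 2 μ := (memLp_const (1 : ℝ)).toLp (fun _ => (1 : ℝ))

lemma varianceForm_toLp {f : Space d → ℝ} (hf : MemLp f 2 μ) :
    varianceForm (oneLp μ) (hf.toLp f) = Var[f; μ] := by
  rw [variance_eq_sub hf, varianceForm, ← real_inner_self_eq_norm_sq, oneLp, inner_toLp_toLp,
    inner_toLp_toLp]
  simp [pow_two]

lemma varianceForm_eq_variance (f : Lp ℝ 2 μ) : varianceForm (oneLp μ) f = Var[f; μ] := by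
  rw [← varianceForm_toLp (Lp.memLp f), Lp.toLp_coeFn]

lemma IsTestFunction.memLp {f : Space d → ℝ} (hf : IsTestFunction f) (p : ℝ≥0∞) : MemLp f p μ :=
  hf.continuous.memLp_of_hasCompactSupport hf.2

variable {L : (Space d → ℝ) → Space d → ℝ} {P : ℝ≥0 → Lp ℝ 2 μ →L[ℝ] Lp ℝ 2 μ}

namespace IsDiffusionSemigroup

variable (hP : IsDiffusionSemigroup μ L P)
include hP

omit [IsProbabilityMeasure μ] in
lemma isStronglyContinuousSemigroup : IsStronglyContinuousSemigroup P :=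
  ⟨hP.zero, hP.add, hP.continuous⟩

omit [IsProbabilityMeasure μ] in
lemma generatorGraph_eq : (generatorGraph P : Set (Lp ℝ 2 μ × Lp ℝ 2 μ)) = closure (testGraph μ L) :=
  hP.generator

/-- Test functions form a core, so any closed condition on pairs `(f, A f)` needs checking only
there. -/
lemma generatorGraph_induction {C : Lp ℝ 2 μ × Lp ℝ 2 μ → Prop} (hC : IsClosed {p | C p})
    (h : ∀ f, IsTestFunction f → ∀ (hf : MemLp f 2 μ) (hLf : MemLp (L f) 2 μ),
      C (hf.toLp f, hLf.toLp (L f))) : ∀ p ∈ generatorGraph P, C p := by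
  intro p hp
  rw [← SetLike.mem_coe, hP.generatorGraph_eq] at hp
  refine closure_minimal ?_ hC hp
  rintro ⟨u, v⟩ ⟨f, hf, h1, h2⟩
  have hLf : MemLp (L f) 2 μ := (Lp.memLp v).ae_eq h2
  have h3 := h f hf (hf.memLp 2) hLf
  have hu : (hf.memLp 2).toLp f = u := Lp.ext ((hf.memLp 2).coeFn_toLp.trans h1.symm)
  have hv : hLf.toLp (L f) = v := Lp.ext (hLf.coeFn_toLp.trans h2.symm)
  rwa [hu, hv] at h3

lemma toLp_mem_generatorGraph {f : Space d → ℝ} (hf : IsTestFunction f)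
    (hLf : MemLp (L f) 2 μ) : ((hf.memLp 2).toLp f, hLf.toLp (L f)) ∈ generatorGraph P := by
  rw [← SetLike.mem_coe, hP.generatorGraph_eq]
  exact subset_closure ⟨f, hf, (hf.memLp 2).coeFn_toLp, hLf.coeFn_toLp⟩

/-- A vector orthogonal to all test functions vanishes, by the fundamental lemma of the calculus of
variations. -/
lemma dense_domain (hL : ∀ f, IsTestFunction f → MemLp (L f) 2 μ) :
    Dense (Prod.fst '' (generatorGraph P : Set (Lp ℝ 2 μ × Lp ℝ 2 μ))) := by
  set R := (generatorGraph P).map (LinearMap.fst ℝ (Lp ℝ 2 μ) (Lp ℝ 2 μ)) with hR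
  have hRS : Prod.fst '' (generatorGraph P : Set (Lp ℝ 2 μ × Lp ℝ 2 μ)) = R := by
    ext; simp [hR]
  rw [hRS, Submodule.dense_iff_topologicalClosure_eq_top, Submodule.topologicalClosure_eq_top_iff,
    Submodule.eq_bot_iff]
  intro h hh
  have h1 : ∀ᵐ x ∂μ, h x = 0 := by
    refine ae_eq_zero_of_integral_contDiff_smul_eq_zero
      (((Lp.memLp h).integrable (by norm_num)).locallyIntegrable) fun g hg hgc => ?_
    have hgt : IsTestFunction g := ⟨hg, hgc⟩
    have h2 : (hgt.memLp 2).toLp g ∈ R := by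
      rw [← SetLike.mem_coe, ← hRS]
      exact ⟨_, hP.toLp_mem_generatorGraph hgt (hL g hgt), rfl⟩
    have h3 := (Submodule.mem_orthogonal R h).1 hh _ h2
    rw [← Lp.toLp_coeFn h (Lp.memLp h), inner_toLp_toLp] at h3
    simpa using h3
  exact (Lp.eq_zero_iff_ae_eq_zero).2 h1

lemma inner_one_eq_zero (h0 : ∀ f, IsTestFunction f → ∫ x, L f x ∂μ = 0) :
    ∀ p ∈ generatorGraph P, ⟪oneLp μ, p.2⟫_ℝ = 0 := by
  refine hP.generatorGraph_induction (isClosed_eq (by fun_prop) (by fun_prop))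
    fun f hf _ hLf => ?_
  rw [oneLp, inner_toLp_toLp]
  simpa using h0 f hf

lemma varianceForm_gap {c : ℝ}
    (hc : ∀ f, IsTestFunction f → c * Var[f; μ] ≤ -∫ x, f x * L f x ∂μ) :
    ∀ p ∈ generatorGraph P, c * varianceForm (oneLp μ) p.1 ≤ -⟪p.1, p.2⟫_ℝ := by
  have hcont := (continuous_varianceForm (oneLp μ)).comp
    (continuous_fst (X := Lp ℝ 2 μ) (Y := Lp ℝ 2 μ))
  refine hP.generatorGraph_induction
    (isClosed_le (continuous_const.mul hcont) (by fun_prop)) fun f hf h1 h2 => ?_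
  simp only
  rw [varianceForm_toLp, inner_toLp_toLp]
  exact hc f hf

/-- A spectral gap inequality for test functions gives exponential decay of the variance. -/
theorem variance_le (hL : ∀ f, IsTestFunction f → MemLp (L f) 2 μ)
    (h0 : ∀ f, IsTestFunction f → ∫ x, L f x ∂μ = 0) {c : ℝ}
    (hc : ∀ f, IsTestFunction f → c * Var[f; μ] ≤ -∫ x, f x * L f x ∂μ)
    {f : Space d → ℝ} (hf : MemLp f 2 μ) (t : ℝ≥0) :
    Var[P t (hf.toLp f); μ] ≤ Real.exp (-2 * c * t) * Var[f; μ] := by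
  rw [← varianceForm_eq_variance, ← varianceForm_toLp hf]
  exact hP.isStronglyContinuousSemigroup.varianceForm_le (hP.dense_domain hL)
    (hP.inner_one_eq_zero h0) (hP.varianceForm_gap hc) _ t

/-- Exponential decay of the variance gives the spectral gap inequality for all functions of
finite energy. -/
theorem mul_variance_le (hL : ∀ f, IsTestFunction f → MemLp (L f) 2 μ)
    (h0 : ∀ f, IsTestFunction f → ∫ x, L f x ∂μ = 0)
    (hneg : ∀ f, IsTestFunction f → 0 ≤ -∫ x, f x * L f x ∂μ) {c : ℝ}
    (hdecay : ∀ (f : Space d → ℝ) (hf : MemLp f 2 μ) (t : ℝ≥0),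
      Var[P t (hf.toLp f); μ] ≤ Real.exp (-2 * c * t) * Var[f; μ])
    {f : Space d → ℝ} (hf : MemLp f 2 μ) {S : ℝ} (hS : 0 ≤ S)
    (hfS : ∀ g, IsTestFunction g →
      (∫ x, f x * L g x ∂μ) ^ 2 ≤ S * -∫ x, g x * L g x ∂μ) :
    c * Var[f; μ] ≤ S := by
  rw [← varianceForm_toLp hf]
  refine hP.isStronglyContinuousSemigroup.spectral_gap_of_finite_energy (hP.dense_domain hL) ?_ ?_
    hS ?_
  · refine hP.generatorGraph_induction (isClosed_le (by fun_prop) (by fun_prop))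
      fun g hg h1 h2 => ?_
    rw [inner_toLp_toLp]
    exact hneg g hg
  · intro p hp
    refine hP.isStronglyContinuousSemigroup.spectral_gap_of_decay (hP.inner_one_eq_zero h0) hp
      fun t => ?_
    have := hdecay p.1 (Lp.memLp p.1) t
    rwa [Lp.toLp_coeFn, ← varianceForm_eq_variance, ← varianceForm_eq_variance] at this
  · refine hP.generatorGraph_induction (isClosed_le (by fun_prop) (by fun_prop))
      fun g hg h1 h2 => ?_
    rw [inner_toLp_toLp, inner_toLp_toLp]
    exact hfS g hg

end IsDiffusionSemigroup

end Diffusion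

/-! ### Gibbs measures -/

section Gibbs

variable {d : ℕ} {σ : ℝ} {W : Space d → ℝ}

lemma integral_gibbs (σ : ℝ) (W F : Space d → ℝ) :
    ∫ x, F x ∂(gibbs σ W) =
      (∫ x, Real.exp (-W x / σ))⁻¹ * ∫ x, Real.exp (-W x / σ) * F x := by
  rw [gibbs, integral_tilted, ← integral_const_mul]
  congr with x
  simp only [smul_eq_mul]
  ring

lemma isProbabilityMeasure_gibbs (hW : Integrable fun x => Real.exp (-W x / σ)) :
    IsProbabilityMeasure (gibbs σ W) :=
  isProbabilityMeasure_tilted hW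

/-- The ratio of unnormalised densities is at most `exp (-m / σ)` and the ratio of normalising
constants is at least `exp (-M / σ)`. Only the oscillation `M - m` survives in the quotient. -/
lemma gibbs_le_smul {W' : Space d → ℝ} {m M : ℝ} (hσ : 0 < σ)
    (hW : Integrable fun x => Real.exp (-W x / σ))
    (hW' : Integrable fun x => Real.exp (-W' x / σ))
    (hm : ∀ x, m ≤ W' x - W x) (hM : ∀ x, W' x - W x ≤ M) :
    gibbs σ W' ≤ ENNReal.ofReal (Real.exp ((M - m) / σ)) • gibbs σ W := by
  have hZ := integral_exp_pos hW
  have hZ' := integral_exp_pos hW'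
  have hZZ : Real.exp (-M / σ) * ∫ x, Real.exp (-W x / σ) ≤ ∫ x, Real.exp (-W' x / σ) := by
    rw [← integral_const_mul]
    refine integral_mono (hW.const_mul _) hW' fun x => ?_
    simp only [← Real.exp_add, ← add_div]
    gcongr
    linarith [hM x]
  have hpt : ∀ x, Real.exp (-W' x / σ) / ∫ x, Real.exp (-W' x / σ) ≤
      Real.exp ((M - m) / σ) * (Real.exp (-W x / σ) / ∫ x, Real.exp (-W x / σ)) := by
    intro x
    have h1 : Real.exp (-W' x / σ) ≤ Real.exp (-m / σ) * Real.exp (-W x / σ) := by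
      rw [← Real.exp_add, ← add_div]
      gcongr
      linarith [hm x]
    have h2 : Real.exp ((M - m) / σ) * Real.exp (-M / σ) = Real.exp (-m / σ) := by
      rw [← Real.exp_add, ← add_div]
      -- Only the exponent identity `(M - m) + (-M) = -m` remains.
      congr 2
      ring
    rw [div_le_iff₀ hZ']
    refine h1.trans ?_
    rw [← h2]
    calc _ = Real.exp ((M - m) / σ) * (Real.exp (-W x / σ) / ∫ x, Real.exp (-W x / σ)) *
          (Real.exp (-M / σ) * ∫ x, Real.exp (-W x / σ)) := by
            generalize (∫ x, Real.exp (-W x / σ)) = I at *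
            rw [mul_mul_mul_comm, div_mul_cancel₀ _ hZ.ne']
      _ ≤ _ := by gcongr
  refine Measure.le_iff.2 fun s hs => ?_
  rw [gibbs, gibbs, Measure.smul_apply, tilted_apply' _ _ hs, tilted_apply' _ _ hs, smul_eq_mul,
    ← lintegral_const_mul' _ _ ENNReal.ofReal_ne_top]
  refine lintegral_mono fun x => ?_
  rw [← ENNReal.ofReal_mul (Real.exp_pos _).le]
  exact ENNReal.ofReal_le_ofReal (hpt x)

lemma integral_le_mul_of_le_smul {α : Type*} [MeasurableSpace α] {μ ν : Measure α} {k : ℝ}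
    (hk : 0 ≤ k) (h : ν ≤ ENNReal.ofReal k • μ) {f : α → ℝ} (hf : Integrable f μ)
    (hf0 : ∀ x, 0 ≤ f x) : ∫ x, f x ∂ν ≤ k * ∫ x, f x ∂μ := by
  have := integral_mono_measure h (Eventually.of_forall hf0) (hf.smul_measure ENNReal.ofReal_ne_top)
  rwa [integral_smul_measure, ENNReal.toReal_ofReal hk] at this

/-- The variance under `ν` is at most the second moment about any constant. Taking the `μ`-mean as
the constant turns the comparison into one of integrals of a nonnegative function. -/
lemma variance_le_mul_of_le_smul {α : Type*} [MeasurableSpace α] {μ ν : Measure α}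
    [IsProbabilityMeasure μ] [IsProbabilityMeasure ν] {k : ℝ}
    (hk : 0 ≤ k) (h : ν ≤ ENNReal.ofReal k • μ) {f : α → ℝ} (hf : MemLp f 2 μ) :
    Var[f; ν] ≤ k * Var[f; μ] := by
  have hfν : MemLp f 2 ν := hf.of_measure_le_smul ENNReal.ofReal_ne_top h
  have hsub : MemLp (fun x => f x - ∫ y, f y ∂μ) 2 μ := hf.sub (memLp_const _)
  rw [variance_eq_integral hf.aemeasurable,
    ← variance_sub_const hfν.aestronglyMeasurable (∫ y, f y ∂μ)]
  refine (variance_le_expectation_sq (hfν.sub (memLp_const _)).aestronglyMeasurable).trans ?_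
  exact integral_le_mul_of_le_smul hk h hsub.integrable_sq fun x => sq_nonneg _

variable {B : Space d → Matrix (Fin d) (Fin d) ℝ}

/-- The Gibbs density cancels the factor `1 / w`, leaving a Lebesgue integral by parts. The flux has
compact support, so `g` needs none; in particular `g = 1` is allowed. -/
lemma integral_mul_divergenceFormOperator (hB : ∀ i j, ContDiff ℝ 1 fun x => B x i j)
    {f g : Space d → ℝ} (hf : IsTestFunction f) (hg : ContDiff ℝ 1 g) :
    ∫ x, g x * divergenceFormOperator σ (fun x => Real.exp (-W x / σ)) B f x ∂(gibbs σ W) =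
      -(σ * ∫ x, (Real.exp (-W x / σ))⁻¹ *
        ⟪gradient g x, WithLp.toLp 2 (B x *ᵥ (gradient f x).ofLp)⟫_ℝ ∂(gibbs σ W)) := by
  have h1 := integral_mul_divergence hg (hf.contDiff_flux hB)
    (hasCompactSupport_flux (B := B) hf.2)
  have h2 : ∀ x, Real.exp (-W x / σ) * (g x * divergenceFormOperator σ
      (fun x => Real.exp (-W x / σ)) B f x) = σ * (g x * divergence
        (fun z => WithLp.toLp 2 (B z *ᵥ (gradient f z).ofLp)) x) := by
    intro x
    have := (Real.exp_pos (-W x / σ)).ne'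
    rw [divergenceFormOperator]
    generalize Real.exp (-W x / σ) = w at *
    field_simp
  have h3 : ∀ x c, Real.exp (-W x / σ) * ((Real.exp (-W x / σ))⁻¹ * c) = c := fun x c =>
    mul_inv_cancel_left₀ (Real.exp_pos _).ne' c
  rw [integral_gibbs, integral_gibbs]
  simp only [h2, h3]
  rw [integral_const_mul, h1]
  ring

lemma integral_divergenceFormOperator (hB : ∀ i j, ContDiff ℝ 1 fun x => B x i j)
    {f : Space d → ℝ} (hf : IsTestFunction f) :
    ∫ x, divergenceFormOperator σ (fun x => Real.exp (-W x / σ)) B f x ∂(gibbs σ W) = 0 := by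
  have := integral_mul_divergenceFormOperator (σ := σ) (W := W) hB hf (contDiff_const (c := (1 : ℝ)))
  have h0 : ∀ x : Space d, gradient (fun _ : Space d => (1 : ℝ)) x = 0 := fun x => by
    simp
  simpa [h0] using this

/-- Continuity of `W` is not assumed, as it will be a free energy known only to be measurable. A
continuous minorant `exp U` of the weight still bounds the operator by a continuous function of
compact support. -/
lemma memLp_divergenceFormOperator (hB : ∀ i j, ContDiff ℝ 1 fun x => B x i j)
    (hW : Integrable fun x => Real.exp (-W x / σ)) {U : Space d → ℝ} (hU : Continuous U)
    (hWU : ∀ x, Real.exp (U x) ≤ Real.exp (-W x / σ)) {f : Space d → ℝ} (hf : IsTestFunction f)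
    (p : ℝ≥0∞) :
    MemLp (divergenceFormOperator σ (fun x => Real.exp (-W x / σ)) B f) p (gibbs σ W) := by
  have := isProbabilityMeasure_gibbs hW
  have hF := hf.contDiff_flux hB
  have hc := continuous_divergence hF
  have hb : Continuous fun x => σ / Real.exp (U x) * divergence
      (fun z => WithLp.toLp 2 (B z *ᵥ (gradient f z).ofLp)) x :=
    (continuous_const.div (Real.continuous_exp.comp hU) fun x => (Real.exp_pos _).ne').mul hc
  have hbc : MemLp (fun x => σ / Real.exp (U x) * divergence
      (fun z => WithLp.toLp 2 (B z *ᵥ (gradient f z).ofLp)) x) p (gibbs σ W) :=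
    hb.memLp_of_hasCompactSupport
      (hasCompactSupport_divergence (hasCompactSupport_flux hf.2)).mul_left
  refine hbc.mono ?_ (Eventually.of_forall fun x => ?_)
  · have h1 := hW.aestronglyMeasurable.aemeasurable.mono_ac
      (tilted_absolutelyContinuous volume (fun x => -W x / σ))
    exact ((h1.const_div σ).mul hc.aemeasurable).aestronglyMeasurable
  · simp only [divergenceFormOperator, norm_mul, norm_div, Real.norm_eq_abs, Real.abs_exp]
    have := hWU x
    gcongr

end Gibbs

/-! ### The torus -/

section Torus

variable {d : ℕ}

lemma unitCell_eq_fundamentalDomain :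
    unitCell d = ZSpan.fundamentalDomain (EuclideanSpace.basisFun (Fin d) ℝ).toBasis := by
  ext z
  simp [unitCell, ZSpan.mem_fundamentalDomain]

lemma measurableSet_unitCell : MeasurableSet (unitCell d) := by
  rw [unitCell_eq_fundamentalDomain]
  exact ZSpan.fundamentalDomain_measurableSet _

lemma isBounded_unitCell : Bornology.IsBounded (unitCell d) := by
  rw [unitCell_eq_fundamentalDomain]
  exact ZSpan.fundamentalDomain_isBounded _

lemma isCompact_closure_unitCell : IsCompact (closure (unitCell d)) :=
  isBounded_unitCell.isCompact_closure

lemma volume_unitCell : volume (unitCell d) = 1 := by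
  rw [unitCell_eq_fundamentalDomain,
    measure_congr (ZSpan.fundamentalDomain_ae_parallelepiped _ volume),
    OrthonormalBasis.coe_toBasis, OrthonormalBasis.volume_parallelepiped]

instance : IsProbabilityMeasure (torusVolume d) :=
  ⟨by rw [torusVolume, Measure.restrict_apply_univ, volume_unitCell]⟩

lemma ae_mem_unitCell : ∀ᵐ z ∂(torusVolume d), z ∈ unitCell d :=
  ae_restrict_mem measurableSet_unitCell

lemma Continuous.memLp_torusVolume {E : Type*} [NormedAddCommGroup E]
    [SecondCountableTopologyEither (Space d) E] {f : Space d → E}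
    (hf : Continuous f) (p : ℝ≥0∞) : MemLp f p (torusVolume d) := by
  obtain ⟨C, hC⟩ := isCompact_closure_unitCell.exists_bound_of_continuousOn hf.continuousOn
  refine MemLp.of_bound hf.aestronglyMeasurable C ?_
  filter_upwards [ae_mem_unitCell] with z hz
  exact hC z (subset_closure hz)

lemma Continuous.integrable_torusVolume {E : Type*} [NormedAddCommGroup E]
    [SecondCountableTopologyEither (Space d) E] {f : Space d → E}
    (hf : Continuous f) : Integrable f (torusVolume d) :=
  memLp_one_iff_integrable.1 (hf.memLp_torusVolume 1)

/-- Invariance under the translations in `ℤᵈ`. -/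
def IsCellPeriodic {E : Type*} (f : Space d → E) : Prop :=
  ∀ (i : Fin d) (z : Space d), f (z + EuclideanSpace.single i 1) = f z

lemma IsCellPeriodic.add_mem_span {E : Type*} {f : Space d → E} (hf : IsCellPeriodic f)
    {v : Space d}
    (hv : v ∈ Submodule.span ℤ (Set.range (EuclideanSpace.basisFun (Fin d) ℝ).toBasis)) :
    ∀ z, f (z + v) = f z := by
  induction hv using Submodule.span_induction with
  | mem x hx =>
    obtain ⟨i, rfl⟩ := hx
    intro z
    simpa using hf i z
  | zero => simp
  | add x y _ _ hx hy => intro z; rw [← add_assoc, hy, hx]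
  | smul n x _ hx =>
    have hneg : ∀ z, f (z - x) = f z := fun z => by rw [← hx (z - x), sub_add_cancel]
    induction n with
    | zero => simp
    | succ n ih => intro z; rw [add_smul, one_smul, ← add_assoc, hx, ih]
    | pred n ih => intro z; rw [sub_smul, one_smul, ← add_sub_assoc, hneg, ih]

/-- A translate of the unit cell is again a fundamental domain of the lattice, and periodic
functions have the same integral over any two of them. -/
lemma IsCellPeriodic.integral_add {E : Type*} [NormedAddCommGroup E] [NormedSpace ℝ E]
    {f : Space d → E} (hf : IsCellPeriodic f) (h : Space d) :
    ∫ z, f (z + h) ∂(torusVolume d) = ∫ z, f z ∂(torusVolume d) := by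
  have : Countable (Submodule.span ℤ
      (Set.range (EuclideanSpace.basisFun (Fin d) ℝ).toBasis)).toAddSubgroup :=
    inferInstanceAs (Countable (Submodule.span ℤ
      (Set.range (EuclideanSpace.basisFun (Fin d) ℝ).toBasis)))
  have h1 := ZSpan.isAddFundamentalDomain' (EuclideanSpace.basisFun (Fin d) ℝ).toBasis volume
  have h2 := h1.vadd_of_comm h
  rw [← unitCell_eq_fundamentalDomain] at h1 h2
  have h3 := h2.setIntegral_eq h1 (f := f) fun g x => by
    rw [AddSubgroup.vadd_def, vadd_eq_add, add_comm]
    exact hf.add_mem_span g.2 x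
  rw [torusVolume, ← h3]
  have h4 := (measurePreserving_add_left volume h).setIntegral_image_emb
    (measurableEmbedding_addLeft h) f (unitCell d)
  simp only [add_comm _ h]
  exact h4.symm

/-! ### Translation estimates and the Poincaré inequality on the torus -/

lemma sq_integral_le {α : Type*} [MeasurableSpace α] {μ : Measure α} [IsProbabilityMeasure μ]
    {f : α → ℝ} (hf : MemLp f 2 μ) : (∫ x, f x ∂μ) ^ 2 ≤ ∫ x, f x ^ 2 ∂μ := by
  have h1 := variance_nonneg f μ
  rw [variance_eq_sub hf] at h1
  simpa using h1

lemma IsCellPeriodic.fderiv {f : Space d → ℝ} (hf : IsCellPeriodic f) :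
    IsCellPeriodic (fderiv ℝ f) := by
  intro i z
  rw [← fderiv_comp_add_right]
  congr 1
  ext y
  exact hf i y

instance : IsProbabilityMeasure (volume.restrict (Set.Ioc (0 : ℝ) 1)) := ⟨by simp⟩

lemma Continuous.integrable_torusVolume_prod_Ioc {f : Space d × ℝ → ℝ} (hf : Continuous f) :
    Integrable f ((torusVolume d).prod (volume.restrict (Set.Ioc (0 : ℝ) 1))) := by
  rw [torusVolume, Measure.prod_restrict]
  refine (hf.locallyIntegrable.integrableOn_isCompact
    (isCompact_closure_unitCell.prod (isCompact_Icc (a := (0 : ℝ)) (b := 1)))).mono_set ?_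
  exact Set.prod_mono subset_closure Set.Ioc_subset_Icc_self

lemma Continuous.integrable_torusVolume_prod {f : Space d × Space d → ℝ} (hf : Continuous f) :
    Integrable f ((torusVolume d).prod (torusVolume d)) := by
  rw [torusVolume, Measure.prod_restrict]
  refine (hf.locallyIntegrable.integrableOn_isCompact
    (isCompact_closure_unitCell.prod isCompact_closure_unitCell)).mono_set ?_
  exact Set.prod_mono subset_closure subset_closure

lemma IsCellPeriodic.integral_integral_segment {F : Space d → ℝ} (hF : IsCellPeriodic F)
    (hc : Continuous F) (h : Space d) :
    ∫ z, (∫ s in Set.Ioc (0 : ℝ) 1, F (z + s • h)) ∂(torusVolume d) = ∫ z, F z ∂(torusVolume d) := by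
  have hint : Integrable (Function.uncurry fun z (s : ℝ) => F (z + s • h))
      ((torusVolume d).prod (volume.restrict (Set.Ioc (0 : ℝ) 1))) :=
    Continuous.integrable_torusVolume_prod_Ioc (by unfold Function.uncurry; fun_prop)
  rw [integral_integral_swap hint]
  simp only [hF.integral_add]
  simp

lemma sub_eq_integral_segment {φ : Space d → ℝ} (hφ : ContDiff ℝ 1 φ) (z h : Space d) :
    φ (z + h) - φ z = ∫ s in Set.Ioc (0 : ℝ) 1, fderiv ℝ φ (z + s • h) h := by
  have hd : ∀ s : ℝ, HasDerivAt (fun s : ℝ => φ (z + s • h)) (fderiv ℝ φ (z + s • h) h) s := by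
    intro s
    have h1 : HasDerivAt (fun s : ℝ => z + s • h) h s := by
      simpa using ((hasDerivAt_id s).smul_const h).const_add z
    exact ((hφ.differentiable one_ne_zero _).hasFDerivAt).comp_hasDerivAt s h1
  have hc : Continuous fun s : ℝ => fderiv ℝ φ (z + s • h) h :=
    ((hφ.continuous_fderiv one_ne_zero).comp (by fun_prop)).clm_apply continuous_const
  have := intervalIntegral.integral_eq_sub_of_hasDerivAt (a := 0) (b := 1) (fun s _ => hd s)
    (hc.intervalIntegrable 0 1)
  rw [← intervalIntegral.integral_of_le zero_le_one, this]
  simp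

/-- Averaging the derivative along the segment from `z` to `z + v` does not change its torus
integral and yields `φ (z + v) - φ z`, which integrates to zero. -/
lemma integral_fderiv_eq_zero_of_periodic {φ : Space d → ℝ} (hφ : ContDiff ℝ 1 φ)
    (hp : IsCellPeriodic φ) (v : Space d) : ∫ z, fderiv ℝ φ z v ∂(torusVolume d) = 0 := by
  have hc : Continuous fun z => fderiv ℝ φ z v :=
    (hφ.continuous_fderiv one_ne_zero).clm_apply continuous_const
  have hp' : IsCellPeriodic fun z => fderiv ℝ φ z v := fun i z => by
    simp only [hp.fderiv i z]
  rw [← hp'.integral_integral_segment hc v]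
  simp only [← sub_eq_integral_segment hφ]
  rw [integral_sub, hp.integral_add, sub_self]
  · exact Continuous.integrable_torusVolume (hφ.continuous.comp (by fun_prop))
  · exact hφ.continuous.integrable_torusVolume

/-- Jensen's inequality along the segment from `z` to `z + h`, followed by translation invariance.
-/
lemma integral_sq_translate_sub_le {φ : Space d → ℝ} (hφ : ContDiff ℝ 1 φ)
    (hp : IsCellPeriodic φ) (h : Space d) :
    ∫ z, (φ (z + h) - φ z) ^ 2 ∂(torusVolume d) ≤
      ‖h‖ ^ 2 * ∫ z, ‖fderiv ℝ φ z‖ ^ 2 ∂(torusVolume d) := by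
  have hc := hφ.continuous_fderiv one_ne_zero
  have hp' : IsCellPeriodic fun z => ‖fderiv ℝ φ z‖ ^ 2 := fun i z => by
    simp only [hp.fderiv i z]
  have hcont : Continuous fun p : Space d × ℝ => ‖fderiv ℝ φ (p.1 + p.2 • h)‖ ^ 2 :=
    (hc.comp (by fun_prop)).norm.pow 2
  rw [← hp'.integral_integral_segment (by fun_prop) h, ← integral_const_mul]
  refine integral_mono ?_ ?_ fun z => ?_
  · exact Continuous.integrable_torusVolume (by have := hφ.continuous; fun_prop)
  · exact hcont.integrable_torusVolume_prod_Ioc.integral_prod_left.const_mul _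
  · have hcs : Continuous fun s : ℝ => fderiv ℝ φ (z + s • h) h :=
      (hc.comp (by fun_prop)).clm_apply continuous_const
    have hcs' : Continuous fun s : ℝ => ‖fderiv ℝ φ (z + s • h)‖ ^ 2 :=
      (hc.comp (by fun_prop)).norm.pow 2
    have hm : ∀ {f : ℝ → ℝ}, Continuous f → MemLp f 2 (volume.restrict (Set.Ioc (0 : ℝ) 1)) := by
      intro f hf
      obtain ⟨C, hC⟩ := (isCompact_Icc (a := (0 : ℝ)) (b := 1)).exists_bound_of_continuousOn
        hf.continuousOn
      refine MemLp.of_bound hf.aestronglyMeasurable C ?_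
      filter_upwards [ae_restrict_mem measurableSet_Ioc] with s hs
      exact hC s (Set.Ioc_subset_Icc_self hs)
    simp only [sub_eq_integral_segment hφ z h]
    refine (sq_integral_le (hm hcs)).trans ?_
    rw [← integral_const_mul]
    refine integral_mono (hm hcs).integrable_sq
      (((hm hcs').integrable (by norm_num)).const_mul _) fun s => ?_
    simp only
    rw [← mul_pow, ← sq_abs, mul_comm]
    gcongr
    exact (fderiv ℝ φ (z + s • h)).le_opNorm h

/-- The Poincare inequality on the torus. -/
theorem exists_torus_poincare (d : ℕ) : ∃ C : ℝ, 0 ≤ C ∧ ∀ φ : Space d → ℝ, ContDiff ℝ 1 φ →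
    IsCellPeriodic φ → ∫ z, φ z ∂(torusVolume d) = 0 →
      ∫ z, φ z ^ 2 ∂(torusVolume d) ≤ C * ∫ z, ‖fderiv ℝ φ z‖ ^ 2 ∂(torusVolume d) := by
  obtain ⟨R, hR⟩ := (isBounded_unitCell (d := d)).exists_norm_le
  -- Only translations by vectors `h` of the unit cell occur, so `‖h‖ ≤ R`.
  refine ⟨R ^ 2, sq_nonneg R, fun φ hφ hp h0 => ?_⟩
  have hc := hφ.continuous
  have hcont : Continuous fun p : Space d × Space d => (φ (p.1 + p.2) - φ p.1) ^ 2 := by fun_prop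
  have hint := hcont.integrable_torusVolume_prod
  calc ∫ z, φ z ^ 2 ∂(torusVolume d)
      ≤ ∫ z, ∫ h, (φ (z + h) - φ z) ^ 2 ∂(torusVolume d) ∂(torusVolume d) := by
        refine integral_mono (hc.memLp_torusVolume 2).integrable_sq hint.integral_prod_left
          fun z => ?_
        have h1 : Continuous fun h => φ (z + h) - φ z := by fun_prop
        -- Since `φ` has mean zero, `-φ z` is the average of its increments; Jensen's inequality
        -- then bounds `φ z ^ 2`.
        have h2 : ∫ h, (φ (z + h) - φ z) ∂(torusVolume d) = -φ z := by
          rw [integral_sub (Continuous.integrable_torusVolume (by fun_prop)) (integrable_const _)]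
          simp only [add_comm z]
          rw [hp.integral_add, h0]
          simp
        have h3 := sq_integral_le (h1.memLp_torusVolume 2)
        rwa [h2, neg_sq] at h3
    _ = ∫ h, ∫ z, (φ (z + h) - φ z) ^ 2 ∂(torusVolume d) ∂(torusVolume d) :=
        integral_integral_swap hint
    _ ≤ ∫ _, R ^ 2 * ∫ z, ‖fderiv ℝ φ z‖ ^ 2 ∂(torusVolume d) ∂(torusVolume d) := by
        refine integral_mono_ae hint.integral_prod_right (integrable_const _) ?_
        filter_upwards [ae_mem_unitCell] with h hh
        refine (integral_sq_translate_sub_le hφ hp h).trans ?_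
        have := hR h hh
        gcongr
    _ = _ := by simp

end Torus

/-! ### Square integrable vector fields on the torus -/

section CellFields

variable {d : ℕ}

/-- Square integrable vector fields on the torus. -/
abbrev CellField (d : ℕ) : Type := Lp (Space d) 2 (torusVolume d)

lemma inner_cellField_toLp {f g : Space d → Space d} (hf : MemLp f 2 (torusVolume d))
    (hg : MemLp g 2 (torusVolume d)) :
    ⟪hf.toLp f, hg.toLp g⟫_ℝ = ∫ z, ⟪f z, g z⟫_ℝ ∂(torusVolume d) := by
  rw [L2.inner_def]
  refine integral_congr_ae ?_
  filter_upwards [hf.coeFn_toLp, hg.coeFn_toLp] with x h1 h2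
  rw [h1, h2]

lemma IsSmoothPeriodic.contDiff_one {φ : Space d → ℝ} (hφ : IsSmoothPeriodic φ) : ContDiff ℝ 1 φ :=
  hφ.1.of_le (by simp)

lemma IsSmoothPeriodic.isCellPeriodic {φ : Space d → ℝ} (hφ : IsSmoothPeriodic φ) :
    IsCellPeriodic φ := hφ.2

lemma IsSmoothPeriodic.differentiable {φ : Space d → ℝ} (hφ : IsSmoothPeriodic φ) :
    Differentiable ℝ φ := hφ.contDiff_one.differentiable one_ne_zero

lemma IsSmoothPeriodic.memLp_gradient {φ : Space d → ℝ} (hφ : IsSmoothPeriodic φ) :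
    MemLp (gradient φ) 2 (torusVolume d) :=
  (hφ.1.gradient (m := 0) (by simp)).continuous.memLp_torusVolume 2

lemma IsSmoothPeriodic.sub {φ ψ : Space d → ℝ} (hφ : IsSmoothPeriodic φ)
    (hψ : IsSmoothPeriodic ψ) : IsSmoothPeriodic (φ - ψ) :=
  ⟨hφ.1.sub hψ.1, fun i z => by simp [hφ.2 i z, hψ.2 i z]⟩

lemma gradient_sub_eq {φ ψ : Space d → ℝ} (hφ : Differentiable ℝ φ) (hψ : Differentiable ℝ ψ) :
    gradient (φ - ψ) = gradient φ - gradient ψ := by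
  ext1 z
  simp only [gradient, Pi.sub_apply]
  rw [fderiv_sub (hφ z) (hψ z), map_sub]

/-- Gradients of smooth functions on the torus. -/
def smoothGradients (d : ℕ) : Submodule ℝ (CellField d) where
  carrier := {u | ∃ φ, IsSmoothPeriodic φ ∧ u =ᵐ[torusVolume d] gradient φ}
  add_mem' := by
    rintro u v ⟨φ, hφ, hu⟩ ⟨ψ, hψ, hv⟩
    refine ⟨φ + ψ, ⟨hφ.1.add hψ.1, fun i z => by simp [hφ.2 i z, hψ.2 i z]⟩, ?_⟩
    filter_upwards [hu, hv, Lp.coeFn_add u v] with z h1 h2 h3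
    rw [h3, Pi.add_apply, h1, h2, gradient, gradient, gradient,
      fderiv_add (hφ.differentiable z) (hψ.differentiable z), map_add]
  zero_mem' := by
    refine ⟨fun _ => 0, ⟨contDiff_const, fun i z => rfl⟩, ?_⟩
    filter_upwards with z
    simp
  smul_mem' := by
    rintro c u ⟨φ, hφ, hu⟩
    refine ⟨c • φ, ⟨hφ.1.const_smul c, fun i z => by simp [hφ.2 i z]⟩, ?_⟩
    filter_upwards [hu, Lp.coeFn_smul c u] with z h1 h2
    rw [h2, Pi.smul_apply, h1, gradient, gradient, fderiv_const_smul (hφ.differentiable z)]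
    simp

/-- Gradients of functions in `H¹(𝕋ᵈ)`. -/
def gradientSpace (d : ℕ) : Submodule ℝ (CellField d) := (smoothGradients d).topologicalClosure

instance : CompleteSpace (gradientSpace d) :=
  (Submodule.isClosed_topologicalClosure _).completeSpace_coe

lemma IsSmoothPeriodic.toLp_gradient_mem {φ : Space d → ℝ} (hφ : IsSmoothPeriodic φ) :
    hφ.memLp_gradient.toLp (gradient φ) ∈ gradientSpace d :=
  Submodule.le_topologicalClosure _ ⟨φ, hφ, hφ.memLp_gradient.coeFn_toLp⟩

lemma gradientSpace_induction {C : CellField d → Prop} (hC : IsClosed {u | C u})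
    (h : ∀ φ (hφ : IsSmoothPeriodic φ), C (hφ.memLp_gradient.toLp (gradient φ))) :
    ∀ u ∈ gradientSpace d, C u := by
  intro u hu
  refine closure_minimal ?_ hC hu
  rintro v ⟨φ, hφ, hv⟩
  have : hφ.memLp_gradient.toLp (gradient φ) = v :=
    Lp.ext (hφ.memLp_gradient.coeFn_toLp.trans hv.symm)
  rw [← this]
  exact h φ hφ

/-- A constant vector field on the torus. -/
def constField (d : ℕ) : Space d →ₗ[ℝ] CellField d where
  toFun v := (memLp_const v).toLp (fun _ => v)
  map_add' _ _ := rfl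
  map_smul' _ _ := rfl

lemma constField_eq_toLp (v : Space d) : constField d v = (memLp_const v).toLp (fun _ => v) := rfl

lemma coeFn_constField (v : Space d) : constField d v =ᵐ[torusVolume d] fun _ => v :=
  (memLp_const v).coeFn_toLp

lemma inner_constField_eq_zero (v : Space d) :
    ∀ u ∈ gradientSpace d, ⟪constField d v, u⟫_ℝ = 0 := by
  refine gradientSpace_induction (isClosed_eq (by fun_prop) (by fun_prop)) fun φ hφ => ?_
  rw [constField_eq_toLp, inner_cellField_toLp]
  have h : ∀ z, ⟪v, gradient φ z⟫_ℝ = fderiv ℝ φ z v := fun z => by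
    rw [real_inner_comm, inner_gradient_eq_fderiv]
  simp only [h]
  exact integral_fderiv_eq_zero_of_periodic hφ.contDiff_one hφ.isCellPeriodic v

lemma norm_sq_constField (v : Space d) : ‖constField d v‖ ^ 2 = ‖v‖ ^ 2 := by
  rw [← real_inner_self_eq_norm_sq, constField_eq_toLp, inner_cellField_toLp]
  simp

/-- Subtracting means leaves the gradients unchanged and makes the Poincaré inequality applicable to
the primitives. -/
lemma exists_smoothPeriodic_seq {u : CellField d} (hu : u ∈ gradientSpace d) :
    ∃ φ : ℕ → Space d → ℝ, (∀ n, IsSmoothPeriodic (φ n)) ∧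
      (∀ n, ∫ z, φ n z ∂(torusVolume d) = 0) ∧
      Tendsto (fun n => eLpNorm (gradient (φ n) - (u : Space d → Space d)) 2 (torusVolume d)) atTop (𝓝 0) := by
  obtain ⟨v, hv, hlim⟩ := mem_closure_iff_seq_limit.1 hu
  choose ψ hψ hψv using hv
  rw [Lp.tendsto_Lp_iff_tendsto_eLpNorm'] at hlim
  refine ⟨fun n z => ψ n z - ∫ y, ψ n y ∂(torusVolume d), fun n => ⟨?_, ?_⟩, fun n => ?_, ?_⟩
  · exact (hψ n).1.sub contDiff_const
  · intro i z
    simp [(hψ n).2 i z]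
  · rw [integral_sub (hψ n).1.continuous.integrable_torusVolume (integrable_const _)]
    simp
  · refine hlim.congr fun n => eLpNorm_congr_ae ?_
    filter_upwards [hψv n] with z hz
    simp [hz, gradient, fderiv_sub_const]

lemma norm_gradient_eq (φ : Space d → ℝ) (z : Space d) : ‖gradient φ z‖ = ‖fderiv ℝ φ z‖ := by
  rw [← toDual_gradient, LinearIsometryEquiv.norm_map]

/-- Convergence of the gradients makes the mean-zero primitives Cauchy in `L²`, by the Poincaré
inequality; their limit is `θ`. -/
theorem exists_isTorusSobolev {u : CellField d} (hu : u ∈ gradientSpace d) :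
    ∃ θ : Space d → ℝ, IsTorusSobolev θ u := by
  obtain ⟨φ, hφ, hφ0, hlim⟩ := exists_smoothPeriodic_seq hu
  obtain ⟨C, hC0, hC⟩ := exists_torus_poincare d
  have hφm : ∀ n, MemLp (φ n) 2 (torusVolume d) := fun n =>
    (hφ n).1.continuous.memLp_torusVolume 2
  have hgc : CauchySeq fun n => (hφ n).memLp_gradient.toLp (gradient (φ n)) := by
    refine Tendsto.cauchySeq (x := u) ?_
    have := (Lp.tendsto_Lp_iff_tendsto_eLpNorm'' (fun n => gradient (φ n))
      (fun n => (hφ n).memLp_gradient) u (Lp.memLp u)).2 hlim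
    rwa [Lp.toLp_coeFn] at this
  have hbound : ∀ n m, ‖(hφm n).toLp (φ n) - (hφm m).toLp (φ m)‖ ≤ √C *
      ‖(hφ n).memLp_gradient.toLp (gradient (φ n)) -
        (hφ m).memLp_gradient.toLp (gradient (φ m))‖ := by
    intro n m
    have hs := (hφ n).sub (hφ m)
    have h0 : ∫ z, (φ n - φ m) z ∂(torusVolume d) = 0 := by
      simp only [Pi.sub_apply]
      rw [integral_sub (hφ n).1.continuous.integrable_torusVolume
        (hφ m).1.continuous.integrable_torusVolume, hφ0, hφ0, sub_self]
    have h1 := hC _ hs.contDiff_one hs.isCellPeriodic h0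
    refine (sq_le_sq₀ (norm_nonneg _) (by positivity)).1 ?_
    rw [mul_pow, Real.sq_sqrt hC0, ← MemLp.toLp_sub, ← MemLp.toLp_sub,
      ← real_inner_self_eq_norm_sq, ← real_inner_self_eq_norm_sq, inner_cellField_toLp,
      inner_toLp_toLp]
    simp only [← gradient_sub_eq (hφ n).differentiable (hφ m).differentiable,
      real_inner_self_eq_norm_sq, norm_gradient_eq, ← pow_two]
    exact h1
  have hcauchy : CauchySeq fun n => (hφm n).toLp (φ n) := by
    rw [Metric.cauchySeq_iff'] at hgc ⊢
    intro ε hε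
    obtain ⟨N, hN⟩ := hgc (ε / (√C + 1)) (by positivity)
    refine ⟨N, fun n hn => ?_⟩
    have h1 := hN n hn
    rw [dist_eq_norm, lt_div_iff₀ (by positivity)] at h1
    rw [dist_eq_norm]
    refine (hbound n N).trans_lt ?_
    nlinarith [norm_nonneg ((hφ n).memLp_gradient.toLp (gradient (φ n)) -
        (hφ N).memLp_gradient.toLp (gradient (φ N)))]
  obtain ⟨θ, hθ⟩ := cauchySeq_tendsto_of_complete hcauchy
  refine ⟨θ, Lp.memLp θ, Lp.memLp u, φ, hφ, ?_, hlim⟩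
  refine (Lp.tendsto_Lp_iff_tendsto_eLpNorm'' φ hφm θ (Lp.memLp θ)).1 ?_
  rwa [Lp.toLp_coeFn]

lemma IsTorusSobolev.toLp_mem {θ : Space d → ℝ} {G : Space d → Space d} (h : IsTorusSobolev θ G) :
    h.2.1.toLp G ∈ gradientSpace d := by
  obtain ⟨φ, hφ, -, hlim⟩ := h.2.2
  have h1 := (Lp.tendsto_Lp_iff_tendsto_eLpNorm'' (fun n => gradient (φ n))
    (fun n => (hφ n).memLp_gradient) G h.2.1).2 hlim
  exact (Submodule.isClosed_topologicalClosure _).mem_of_tendsto h1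
    (Eventually.of_forall fun n => (hφ n).toLp_gradient_mem)

/-! ### Multiplication by a coefficient field -/

lemma memLp_coefficient_apply (a : C(Space d, Space d →L[ℝ] Space d)) {u : Space d → Space d}
    (hu : MemLp u 2 (torusVolume d)) : MemLp (fun z => a z (u z)) 2 (torusVolume d) := by
  obtain ⟨C, hC⟩ := isCompact_closure_unitCell (d := d).exists_bound_of_continuousOn
    a.continuous.continuousOn
  refine hu.of_le_mul (c := C) ?_ ?_
  · exact isBoundedBilinearMap_apply.continuous.comp_aestronglyMeasurable
      (a.continuous.aestronglyMeasurable.prodMk hu.1)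
  · filter_upwards [ae_mem_unitCell] with z hz
    exact (a z).le_of_opNorm_le (hC z (subset_closure hz)) _

/-- The multiplication operator on `L²(𝕋ᵈ)ᵈ` by a continuous coefficient field. -/
def cellOperatorAux (a : C(Space d, Space d →L[ℝ] Space d)) : CellField d →ₗ[ℝ] CellField d where
  toFun u := (memLp_coefficient_apply a (Lp.memLp u)).toLp _
  map_add' u v := by
    refine Lp.ext ?_
    filter_upwards [MemLp.coeFn_toLp (memLp_coefficient_apply a (Lp.memLp (u + v))),
      MemLp.coeFn_toLp (memLp_coefficient_apply a (Lp.memLp u)),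
      MemLp.coeFn_toLp (memLp_coefficient_apply a (Lp.memLp v)), Lp.coeFn_add u v,
      Lp.coeFn_add ((memLp_coefficient_apply a (Lp.memLp u)).toLp _)
        ((memLp_coefficient_apply a (Lp.memLp v)).toLp _)] with z h1 h2 h3 h4 h5
    rw [h1, h5, Pi.add_apply, h2, h3, h4, Pi.add_apply, map_add]
  map_smul' c u := by
    refine Lp.ext ?_
    filter_upwards [MemLp.coeFn_toLp (memLp_coefficient_apply a (Lp.memLp (c • u))),
      MemLp.coeFn_toLp (memLp_coefficient_apply a (Lp.memLp u)), Lp.coeFn_smul c u,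
      Lp.coeFn_smul c ((memLp_coefficient_apply a (Lp.memLp u)).toLp _)] with z h1 h2 h3 h4
    rw [h1, RingHom.id_apply, h4, Pi.smul_apply, h2, h3, Pi.smul_apply, map_smul]

lemma norm_cellOperatorAux_le (a : C(Space d, Space d →L[ℝ] Space d)) {C : ℝ}
    (hC : ∀ z ∈ unitCell d, ‖a z‖ ≤ C) (u : CellField d) : ‖cellOperatorAux a u‖ ≤ C * ‖u‖ := by
  refine Lp.norm_le_mul_norm_of_ae_le_mul ?_
  filter_upwards [MemLp.coeFn_toLp (memLp_coefficient_apply a (Lp.memLp u)),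
    ae_mem_unitCell] with z h1 hz
  change ‖(memLp_coefficient_apply a (Lp.memLp u)).toLp _ z‖ ≤ _
  rw [h1]
  exact (a z).le_of_opNorm_le (hC z hz) _

/-- The multiplication operator on `L²(𝕋ᵈ)ᵈ` by a continuous coefficient field, as a linear function
of the coefficient field. -/
def cellOperator (d : ℕ) :
    C(Space d, Space d →L[ℝ] Space d) →ₗ[ℝ] (CellField d →L[ℝ] CellField d) where
  toFun a := (cellOperatorAux a).mkContinuousOfExistsBound <| by
    obtain ⟨C, hC⟩ := isCompact_closure_unitCell (d := d).exists_bound_of_continuousOn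
      a.continuous.continuousOn
    exact ⟨C, norm_cellOperatorAux_le a fun z hz => hC z (subset_closure hz)⟩
  map_add' a b := by
    ext1 u
    refine Lp.ext ?_
    filter_upwards [MemLp.coeFn_toLp (memLp_coefficient_apply (a + b) (Lp.memLp u)),
      MemLp.coeFn_toLp (memLp_coefficient_apply a (Lp.memLp u)),
      MemLp.coeFn_toLp (memLp_coefficient_apply b (Lp.memLp u)),
      Lp.coeFn_add ((memLp_coefficient_apply a (Lp.memLp u)).toLp _)
        ((memLp_coefficient_apply b (Lp.memLp u)).toLp _)] with z h1 h2 h3 h4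
    exact h1.trans (by refine Eq.trans ?_ h4.symm; rw [Pi.add_apply, h2, h3]; rfl)
  map_smul' c a := by
    ext1 u
    refine Lp.ext ?_
    filter_upwards [MemLp.coeFn_toLp (memLp_coefficient_apply (c • a) (Lp.memLp u)),
      MemLp.coeFn_toLp (memLp_coefficient_apply a (Lp.memLp u)),
      Lp.coeFn_smul c ((memLp_coefficient_apply a (Lp.memLp u)).toLp _)] with z h1 h2 h4
    exact h1.trans (by refine Eq.trans ?_ h4.symm; rw [Pi.smul_apply, h2]; rfl)

lemma coeFn_cellOperator (a : C(Space d, Space d →L[ℝ] Space d)) (u : CellField d) :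
    cellOperator d a u =ᵐ[torusVolume d] fun z => a z (u z) :=
  MemLp.coeFn_toLp (memLp_coefficient_apply a (Lp.memLp u))

lemma norm_cellOperator_le (a : C(Space d, Space d →L[ℝ] Space d)) {C : ℝ} (hC0 : 0 ≤ C)
    (hC : ∀ z ∈ unitCell d, ‖a z‖ ≤ C) : ‖cellOperator d a‖ ≤ C :=
  ContinuousLinearMap.opNorm_le_bound _ hC0 (norm_cellOperatorAux_le a hC)

lemma inner_cellOperator (a : C(Space d, Space d →L[ℝ] Space d)) (u v : CellField d) :
    ⟪v, cellOperator d a u⟫_ℝ = ∫ z, ⟪v z, a z (u z)⟫_ℝ ∂(torusVolume d) := by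
  rw [L2.inner_def]
  refine integral_congr_ae ?_
  filter_upwards [coeFn_cellOperator a u] with z hz
  rw [hz]

lemma inner_cellOperator_ge {a : C(Space d, Space d →L[ℝ] Space d)} {l : ℝ}
    (ha : ∀ z u, l * ‖u‖ ^ 2 ≤ ⟪u, a z u⟫_ℝ) (u : CellField d) :
    l * ‖u‖ ^ 2 ≤ ⟪u, cellOperator d a u⟫_ℝ := by
  rw [← real_inner_self_eq_norm_sq, L2.inner_def, inner_cellOperator, ← integral_const_mul]
  refine integral_mono ((L2.integrable_inner u u).const_mul l) ?_ fun z => ?_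
  · refine (L2.integrable_inner (𝕜 := ℝ) u (cellOperator d a u)).congr ?_
    filter_upwards [coeFn_cellOperator a u] with z hz
    rw [hz]
  · simpa only [real_inner_self_eq_norm_sq] using ha z (u z)

end CellFields

/-! ### Differentiability of the multiplication operator in a parameter -/

section Parameter

variable {d : ℕ} {E : Type*} [NormedAddCommGroup E]

/-- Compactness of the closed cell makes continuity in the parameter uniform in `z`. -/
lemma eventually_forall_unitCell_norm_sub_le {F : Type*} [NormedAddCommGroup F]
    {g : E × Space d → F} (hg : Continuous g) (x₀ : E) {ε : ℝ} (hε : 0 < ε) :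
    ∀ᶠ x in 𝓝 x₀, ∀ z ∈ unitCell d, ‖g (x, z) - g (x₀, z)‖ ≤ ε := by
  have h : ∀ᶠ x in 𝓝 x₀, ∀ z ∈ closure (unitCell d), ‖g (x, z) - g (x₀, z)‖ < ε := by
    refine isCompact_closure_unitCell.eventually_forall_of_forall_eventually fun z _ => ?_
    have hc : Continuous fun p : E × Space d => ‖g (p.1, p.2) - g (x₀, p.2)‖ := by fun_prop
    exact hc.continuousAt.eventually_lt continuousAt_const (by simpa using hε)
  filter_upwards [h] with x hx z hz
  exact (hx z (subset_closure hz)).le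

lemma exists_bound_unitCell {F : Type*} [NormedAddCommGroup F] (b : C(Space d, F)) :
    ∃ C : ℝ, 0 ≤ C ∧ ∀ z ∈ unitCell d, ‖b z‖ ≤ C := by
  obtain ⟨C, hC⟩ := isCompact_closure_unitCell (d := d).exists_bound_of_continuousOn
    b.continuous.continuousOn
  exact ⟨max C 0, le_max_right _ _, fun z hz => (hC z (subset_closure hz)).trans (le_max_left _ _)⟩

variable [NormedSpace ℝ E]

/-- The coefficient field `z ↦ b z v`. -/
def directionalField (b : C(Space d, E →L[ℝ] (Space d →L[ℝ] Space d))) (v : E) :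
    C(Space d, Space d →L[ℝ] Space d) :=
  ⟨fun z => b z v, b.continuous.clm_apply continuous_const⟩

lemma norm_cellOperator_directionalField_le (b : C(Space d, E →L[ℝ] (Space d →L[ℝ] Space d)))
    {C : ℝ} (hC0 : 0 ≤ C) (hC : ∀ z ∈ unitCell d, ‖b z‖ ≤ C) (v : E) :
    ‖cellOperator d (directionalField b v)‖ ≤ C * ‖v‖ :=
  norm_cellOperator_le _ (by positivity) fun z hz => (b z).le_of_opNorm_le (hC z hz) v

/-- The linear map sending `v` to the multiplication by `z ↦ b z v`. -/
def cellOperatorFamily (b : C(Space d, E →L[ℝ] (Space d →L[ℝ] Space d))) :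
    E →L[ℝ] (CellField d →L[ℝ] CellField d) :=
  LinearMap.mkContinuousOfExistsBound
    { toFun := fun v => cellOperator d (directionalField b v)
      map_add' := fun v w => by
        rw [← map_add]
        congr 1
        ext1 z
        exact map_add (b z) v w
      map_smul' := fun c v => by
        rw [RingHom.id_apply, ← map_smul]
        congr 1
        ext1 z
        exact map_smul (b z) c v }
    (by
      obtain ⟨C, hC0, hC⟩ := exists_bound_unitCell (F := E →L[ℝ] (Space d →L[ℝ] Space d)) b
      exact ⟨C, norm_cellOperator_directionalField_le b hC0 hC⟩)

lemma cellOperatorFamily_apply (b : C(Space d, E →L[ℝ] (Space d →L[ℝ] Space d))) (v : E) :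
    cellOperatorFamily b v = cellOperator d (directionalField b v) := rfl

lemma norm_cellOperatorFamily_sub_le (b b' : C(Space d, E →L[ℝ] (Space d →L[ℝ] Space d)))
    {C : ℝ} (hC0 : 0 ≤ C) (hC : ∀ z ∈ unitCell d, ‖b z - b' z‖ ≤ C) :
    ‖cellOperatorFamily b - cellOperatorFamily b'‖ ≤ C := by
  refine ContinuousLinearMap.opNorm_le_bound _ hC0 fun v => ?_
  rw [sub_apply, cellOperatorFamily_apply, cellOperatorFamily_apply, ← map_sub]
  exact norm_cellOperator_directionalField_le (b - b') hC0 hC v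

/-- The operator norm of a multiplication is bounded by the supremum of its coefficient over the
cell. Differentiating the coefficient pointwise therefore suffices, provided the remainder is
uniform in `z`. -/
theorem contDiff_cellOperator {a : E → C(Space d, Space d →L[ℝ] Space d)}
    (ha : ContDiff ℝ 1 fun p : E × Space d => a p.1 p.2) :
    ContDiff ℝ 1 fun x => cellOperator d (a x) := by
  set f : E × Space d → (Space d →L[ℝ] Space d) := fun p => a p.1 p.2 with hf
  set D : E × Space d → (E →L[ℝ] (Space d →L[ℝ] Space d)) := fun p =>
    (fderiv ℝ f p).comp (ContinuousLinearMap.inl ℝ E (Space d)) with hD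
  have hDc : Continuous D := (ha.continuous_fderiv one_ne_zero).clm_comp continuous_const
  have hder : ∀ x z, HasFDerivAt (fun y => a y z) (D (x, z)) x := fun x z => by
    have h1 : HasFDerivAt (fun y : E => (y, z)) (ContinuousLinearMap.inl ℝ E (Space d)) x :=
      hasFDerivAt_prodMk_left x z
    exact (ha.differentiable one_ne_zero (x, z)).hasFDerivAt.comp x h1
  let b : E → C(Space d, E →L[ℝ] (Space d →L[ℝ] Space d)) := fun x =>
    ⟨fun z => D (x, z), hDc.comp (by fun_prop)⟩
  rw [contDiff_one_iff_hasFDerivAt]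
  refine ⟨fun x => cellOperatorFamily (b x), ?_, fun x₀ => ?_⟩
  · rw [continuous_iff_continuousAt]
    intro x₀
    rw [ContinuousAt, tendsto_iff_norm_sub_tendsto_zero, Metric.tendsto_nhds]
    intro ε hε
    filter_upwards [eventually_forall_unitCell_norm_sub_le
      (F := E →L[ℝ] (Space d →L[ℝ] Space d)) hDc x₀ (half_pos hε)] with x hx
    rw [dist_zero_right, norm_norm]
    exact (norm_cellOperatorFamily_sub_le (b x) (b x₀) (half_pos hε).le hx).trans_lt
      (half_lt_self hε)
  · refine HasFDerivAt.of_isLittleO (Asymptotics.isLittleO_iff.2 fun c hc => ?_)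
    obtain ⟨r, hr, hball⟩ := Metric.eventually_nhds_iff_ball.1
      (eventually_forall_unitCell_norm_sub_le
        (F := E →L[ℝ] (Space d →L[ℝ] Space d)) hDc x₀ hc)
    filter_upwards [Metric.ball_mem_nhds x₀ hr] with x hx
    rw [cellOperatorFamily_apply, ← map_sub, ← map_sub]
    refine norm_cellOperator_le _ (by positivity) fun z hz => ?_
    -- Mean value inequality on a ball where the derivative stays within `c` of its value at `x₀`,
    -- for all `z` in the cell at once.
    have h1 : ‖a x z - a x₀ z - D (x₀, z) (x - x₀)‖ ≤ c * ‖x - x₀‖ :=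
      (convex_ball x₀ r).norm_image_sub_le_of_norm_hasFDerivWithin_le'
        (f := fun y => a y z) (f' := fun y => D (y, z)) (φ := D (x₀, z))
        (fun y _ => (hder y z).hasFDerivWithinAt) (fun y hy => hball y hy z hz)
        (Metric.mem_ball_self hr) hx
    exact h1

end Parameter

/-! ### Correctors -/

section Corrector

variable {d : ℕ}

/-- The compression of the multiplication operator to the gradient fields. -/
def gradientOperator (a : C(Space d, Space d →L[ℝ] Space d)) :
    gradientSpace d →L[ℝ] gradientSpace d :=
  ((gradientSpace d).orthogonalProjectionOnto.comp (cellOperator d a)).comp (gradientSpace d).subtypeL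

/-- The gradients of the correctors, as a linear function of the direction. -/
def correctorMap (a : C(Space d, Space d →L[ℝ] Space d)) : Space d →ₗ[ℝ] gradientSpace d :=
  -(((ContinuousLinearMap.inverse (gradientOperator a)).comp
    ((gradientSpace d).orthogonalProjectionOnto.comp (cellOperator d a))).toLinearMap ∘ₗ constField d)

/-- The total field `w + ∇θ_w`. -/
def totalField (a : C(Space d, Space d →L[ℝ] Space d)) : Space d →ₗ[ℝ] CellField d :=
  constField d + (gradientSpace d).subtype ∘ₗ correctorMap a

/-- The bilinear form of the homogenized coefficient. -/
def effectiveForm (a : C(Space d, Space d →L[ℝ] Space d)) (v w : Space d) : ℝ :=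
  ⟪constField d v, cellOperator d a (totalField a w)⟫_ℝ

lemma totalField_apply (a : C(Space d, Space d →L[ℝ] Space d)) (w : Space d) :
    totalField a w = constField d w + (correctorMap a w : CellField d) := rfl

lemma inner_orthogonalProjection_gradientSpace (v : gradientSpace d) (u : CellField d) :
    ⟪v, (gradientSpace d).orthogonalProjectionOnto u⟫_ℝ = ⟪(v : CellField d), u⟫_ℝ :=
  by rw [real_inner_comm, Submodule.inner_orthogonalProjectionOnto_eq_of_mem_right, real_inner_comm]

/-- Uniform ellipticity of a coefficient field. -/
def IsElliptic (l : ℝ) (a : C(Space d, Space d →L[ℝ] Space d)) : Prop :=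
  ∀ z u, l * ‖u‖ ^ 2 ≤ ⟪u, a z u⟫_ℝ

variable {a : C(Space d, Space d →L[ℝ] Space d)} {l : ℝ}

/-- Lax-Milgram: ellipticity makes the compressed operator coercive on gradient fields. -/
lemma IsElliptic.exists_equiv (ha : IsElliptic l a) (hl : 0 < l) :
    ∃ e : gradientSpace d ≃L[ℝ] gradientSpace d,
      (e : gradientSpace d →L[ℝ] gradientSpace d) = gradientOperator a := by
  have hco : IsCoercive ((innerSL ℝ).comp (gradientOperator a)) := by
    refine ⟨l, hl, fun u => ?_⟩
    have h1 := inner_cellOperator_ge ha (u : CellField d)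
    have h2 : ((innerSL ℝ).comp (gradientOperator a)) u u =
        ⟪(u : CellField d), cellOperator d a u⟫_ℝ := by
      rw [← inner_orthogonalProjection_gradientSpace, real_inner_comm]
      rfl
    rw [h2, mul_assoc, ← pow_two]
    exact h1
  refine ⟨hco.continuousLinearEquivOfBilin, ?_⟩
  ext1 u
  refine ext_inner_right ℝ fun w => ?_
  exact hco.continuousLinearEquivOfBilin_apply u w

/-- The weak form of the corrector equation, tested against all gradient fields. -/
lemma IsElliptic.inner_totalField (ha : IsElliptic l a) (hl : 0 < l) (w : Space d) :
    ∀ v ∈ gradientSpace d, ⟪v, cellOperator d a (totalField a w)⟫_ℝ = 0 := by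
  intro v hv
  obtain ⟨e, he⟩ := ha.exists_equiv hl
  have h1 : gradientOperator a (correctorMap a w) =
      -(gradientSpace d).orthogonalProjectionOnto (cellOperator d a (constField d w)) := by
    rw [correctorMap, ← he, ContinuousLinearMap.inverse_equiv]
    simp
  have h2 : (gradientSpace d).orthogonalProjectionOnto (cellOperator d a (totalField a w)) = 0 := by
    rw [totalField_apply, map_add, map_add]
    change _ + gradientOperator a (correctorMap a w) = 0
    rw [h1, add_neg_cancel]
  have h3 := inner_orthogonalProjection_gradientSpace ⟨v, hv⟩ (cellOperator d a (totalField a w))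
  rw [h2, inner_zero_right] at h3
  exact h3.symm

/-- Testing the difference of two solutions against itself and using ellipticity gives uniqueness.
-/
lemma IsElliptic.eq_correctorMap (ha : IsElliptic l a) (hl : 0 < l) {w : Space d} {u : CellField d}
    (hu : u ∈ gradientSpace d)
    (h : ∀ v ∈ gradientSpace d, ⟪v, cellOperator d a (constField d w + u)⟫_ℝ = 0) :
    u = correctorMap a w := by
  have hsub : u - correctorMap a w ∈ gradientSpace d := sub_mem hu (correctorMap a w).2
  have h1 := h _ hsub
  have h2 := ha.inner_totalField hl w _ hsub
  have h3 := inner_cellOperator_ge ha (u - correctorMap a w)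
  have h4 : u - correctorMap a w = (constField d w + u) - totalField a w := by
    rw [totalField_apply]; abel
  have h5 : ⟪u - correctorMap a w, cellOperator d a (u - correctorMap a w)⟫_ℝ = 0 := by
    nth_rewrite 2 [h4]
    rw [map_sub, inner_sub_right, h1, h2, sub_zero]
  rw [h5] at h3
  have h6 : ‖u - correctorMap a w‖ ^ 2 ≤ 0 := by
    by_contra hcon
    push Not at hcon
    nlinarith
  rw [← sub_eq_zero, ← norm_eq_zero]
  exact pow_eq_zero_iff two_ne_zero |>.1 (le_antisymm h6 (sq_nonneg _))

lemma IsElliptic.effectiveForm_eq (ha : IsElliptic l a) (hl : 0 < l) (v w : Space d) :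
    effectiveForm a v w = ⟪totalField a v, cellOperator d a (totalField a w)⟫_ℝ := by
  rw [totalField_apply a v, inner_add_left, ha.inner_totalField hl w _ (correctorMap a v).2,
    add_zero, effectiveForm]

/-- Constant fields are orthogonal to gradients, so adding a corrector can only increase the `L²`
norm. Hence homogenization does not lower the ellipticity constant. -/
lemma IsElliptic.le_effectiveForm (ha : IsElliptic l a) (hl : 0 < l) (v : Space d) :
    l * ‖v‖ ^ 2 ≤ effectiveForm a v v := by
  rw [ha.effectiveForm_eq hl]
  refine le_trans ?_ (inner_cellOperator_ge ha _)
  rw [totalField_apply, norm_add_sq_real, inner_constField_eq_zero _ _ (correctorMap a v).2,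
    norm_sq_constField]
  nlinarith [sq_nonneg ‖(correctorMap a v : CellField d)‖]

lemma effectiveForm_sum_sum (a : C(Space d, Space d →L[ℝ] Space d)) {ι : Type*} (s : Finset ι)
    (c : ι → ℝ) (e : ι → Space d) :
    effectiveForm a (∑ i ∈ s, c i • e i) (∑ i ∈ s, c i • e i) =
      ∑ i ∈ s, c i * ∑ j ∈ s, effectiveForm a (e i) (e j) * c j := by
  simp only [effectiveForm, map_sum, map_smul, sum_inner, inner_sum, inner_smul_left,
    inner_smul_right, Finset.mul_sum]
  rw [Finset.sum_comm]
  refine Finset.sum_congr rfl fun i _ => Finset.sum_congr rfl fun j _ => ?_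
  simp only [conj_trivial]
  ring

/-- The corrector is a fixed linear expression in the multiplication operator and the inverse of its
compression, and inversion is smooth at invertible operators. -/
theorem contDiff_effectiveForm {E : Type*} [NormedAddCommGroup E] [NormedSpace ℝ E]
    {a : E → C(Space d, Space d →L[ℝ] Space d)} {l : E → ℝ}
    (ha : ContDiff ℝ 1 fun p : E × Space d => a p.1 p.2) (hl : ∀ x, 0 < l x)
    (hel : ∀ x, IsElliptic (l x) (a x)) (v w : Space d) :
    ContDiff ℝ 1 fun x => effectiveForm (a x) v w := by
  have hT := contDiff_cellOperator ha
  have hP : ContDiff ℝ 1 fun x => (gradientSpace d).orthogonalProjectionOnto.comp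
      (cellOperator d (a x)) := contDiff_const.clm_comp hT
  have hS : ContDiff ℝ 1 fun x => gradientOperator (a x) := hP.clm_comp contDiff_const
  have hI : ContDiff ℝ 1 fun x => ContinuousLinearMap.inverse (gradientOperator (a x)) := by
    rw [contDiff_iff_contDiffAt]
    intro x
    obtain ⟨e, he⟩ := (hel x).exists_equiv (hl x)
    have h1 := contDiffAt_map_inverse (𝕜 := ℝ) (n := 1) e
    rw [he] at h1
    exact h1.comp x hS.contDiffAt
  have hC : ContDiff ℝ 1 fun x => (correctorMap (a x) w : CellField d) := by
    have h1 : ContDiff ℝ 1 fun x => correctorMap (a x) w :=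
      (hI.clm_apply (hP.clm_apply (contDiff_const (c := constField d w)))).neg
    exact (gradientSpace d).subtypeL.contDiff.comp h1
  exact contDiff_const.inner ℝ (hT.clm_apply (contDiff_const.add hC))

end Corrector

/-! ### Homogenization of matrix fields -/

section MatrixFields

variable {d : ℕ}

lemma toEuclideanCLM_eq_sum (M : Matrix (Fin d) (Fin d) ℝ) :
    Matrix.toEuclideanCLM (𝕜 := ℝ) M =
      ∑ i, ∑ j, M i j • Matrix.toEuclideanCLM (𝕜 := ℝ) (Matrix.single i j (1 : ℝ)) := by
  conv_lhs => rw [Matrix.matrix_eq_sum_single M]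
  simp only [map_sum, ← map_smul, Matrix.smul_single, smul_eq_mul, mul_one]

lemma continuous_toEuclideanCLM {X : Type*} [TopologicalSpace X]
    {A : X → Matrix (Fin d) (Fin d) ℝ} (hA : ∀ i j, Continuous fun x => A x i j) :
    Continuous fun x => Matrix.toEuclideanCLM (𝕜 := ℝ) (A x) := by
  simp only [toEuclideanCLM_eq_sum (A _)]
  exact continuous_finsetSum _ fun i _ => continuous_finsetSum _ fun j _ =>
    (hA i j).smul continuous_const

lemma contDiff_toEuclideanCLM {X : Type*} [NormedAddCommGroup X] [NormedSpace ℝ X]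
    {n : WithTop ℕ∞} {A : X → Matrix (Fin d) (Fin d) ℝ}
    (hA : ∀ i j, ContDiff ℝ n fun x => A x i j) :
    ContDiff ℝ n fun x => Matrix.toEuclideanCLM (𝕜 := ℝ) (A x) := by
  simp only [toEuclideanCLM_eq_sum (A _)]
  exact ContDiff.sum fun i _ => ContDiff.sum fun j _ => (hA i j).smul contDiff_const

/-- A continuous matrix field as a coefficient field. -/
def matrixField (A : Space d → Matrix (Fin d) (Fin d) ℝ) (hA : ∀ i j, Continuous fun z => A z i j) :
    C(Space d, Space d →L[ℝ] Space d) :=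
  ⟨fun z => Matrix.toEuclideanCLM (𝕜 := ℝ) (A z), continuous_toEuclideanCLM hA⟩

lemma inner_eq_dotProduct (u v : Space d) : ⟪u, v⟫_ℝ = u.ofLp ⬝ᵥ v.ofLp := by
  rw [real_inner_eq_sum]; rfl

lemma inner_matrixField (A : Space d → Matrix (Fin d) (Fin d) ℝ)
    (hA : ∀ i j, Continuous fun z => A z i j) (z u v : Space d) :
    ⟪u, matrixField A hA z v⟫_ℝ = u.ofLp ⬝ᵥ (A z *ᵥ v.ofLp) :=
  inner_eq_dotProduct _ _

variable {A : Space d → Matrix (Fin d) (Fin d) ℝ} {l : ℝ}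

lemma isElliptic_matrixField (hA : ∀ i j, Continuous fun z => A z i j)
    (hel : ∀ z (v : Space d), l * ‖v‖ ^ 2 ≤ v.ofLp ⬝ᵥ (A z *ᵥ v.ofLp)) :
    IsElliptic l (matrixField A hA) := fun z u => by
  rw [inner_matrixField]; exact hel z u

/-- For elliptic fields the corrector is the one given by the Lax-Milgram theorem. -/
lemma correctorGradient_ae_eq (hA : ∀ i j, Continuous fun z => A z i j) (hl : 0 < l)
    (hel : ∀ z (v : Space d), l * ‖v‖ ^ 2 ≤ v.ofLp ⬝ᵥ (A z *ᵥ v.ofLp)) (j : Fin d) :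
    correctorGradient A j =ᵐ[torusVolume d]
      (correctorMap (matrixField A hA) (EuclideanSpace.single j 1) : CellField d) := by
  have ha := isElliptic_matrixField hA hel
  set e : Space d := EuclideanSpace.single j 1 with he
  have hint : ∀ (φ : Space d → ℝ) (hφ : IsSmoothPeriodic φ) (u : CellField d),
      ⟪hφ.memLp_gradient.toLp (gradient φ), cellOperator d (matrixField A hA)
        (constField d e + u)⟫_ℝ =
      ∫ z, (gradient φ z).ofLp ⬝ᵥ (A z *ᵥ (u z + e).ofLp) ∂(torusVolume d) := by
    intro φ hφ u
    rw [inner_cellOperator]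
    refine integral_congr_ae ?_
    filter_upwards [hφ.memLp_gradient.coeFn_toLp, Lp.coeFn_add (constField d e) u,
      coeFn_constField e] with z h1 h2 h3
    rw [h1, h2, Pi.add_apply, h3, inner_matrixField, add_comm]
  -- The Lax-Milgram solution shows that the choice in `correctorGradient` takes the nontrivial
  -- branch.
  have hex : ∃ G : Space d → Space d, ∃ θ : Space d → ℝ, IsCorrector A j θ G := by
    set u := correctorMap (matrixField A hA) e with hu
    obtain ⟨θ, hθ⟩ := exists_isTorusSobolev u.2
    refine ⟨(u : CellField d), θ, hθ, fun φ hφ => ?_⟩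
    rw [← hint φ hφ]
    exact ha.inner_totalField hl e _ hφ.toLp_gradient_mem
  obtain ⟨θ, hθ, hweak⟩ : ∃ θ, IsCorrector A j θ (correctorGradient A j) := by
    rw [correctorGradient, dif_pos hex]
    exact hex.choose_spec
  have hmem := hθ.toLp_mem
  have hae := hθ.2.1.coeFn_toLp
  -- The equation for the chosen gradient is known only against smooth functions; closure extends it
  -- to all gradient fields, and uniqueness applies.
  have := ha.eq_correctorMap hl (w := e) hmem <| by
    refine gradientSpace_induction (isClosed_eq (by fun_prop) (by fun_prop)) fun φ hφ => ?_
    rw [hint φ hφ, ← hweak φ hφ]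
    refine integral_congr_ae ?_
    filter_upwards [hae] with z hz
    rw [hz]
  rw [← this]
  exact hae.symm

lemma homogenizeCell_apply (hA : ∀ i j, Continuous fun z => A z i j) (hl : 0 < l)
    (hel : ∀ z (v : Space d), l * ‖v‖ ^ 2 ≤ v.ofLp ⬝ᵥ (A z *ᵥ v.ofLp)) (i j : Fin d) :
    homogenizeCell A i j = effectiveForm (matrixField A hA) (EuclideanSpace.single i 1)
      (EuclideanSpace.single j 1) := by
  rw [homogenizeCell, Matrix.of_apply, effectiveForm, inner_cellOperator]
  refine integral_congr_ae ?_
  filter_upwards [correctorGradient_ae_eq hA hl hel j,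
    Lp.coeFn_add (constField d (EuclideanSpace.single j 1))
      (correctorMap (matrixField A hA) (EuclideanSpace.single j 1) : CellField d),
    coeFn_constField (EuclideanSpace.single j (1 : ℝ)),
    coeFn_constField (EuclideanSpace.single i (1 : ℝ))] with z h1 h2 h3 h4
  rw [h4, totalField_apply, h2, Pi.add_apply, h3, ← h1, inner_matrixField]
  simp

lemma le_homogenizeCell (hA : ∀ i j, Continuous fun z => A z i j) (hl : 0 < l)
    (hel : ∀ z (v : Space d), l * ‖v‖ ^ 2 ≤ v.ofLp ⬝ᵥ (A z *ᵥ v.ofLp)) (v : Space d) :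
    l * ‖v‖ ^ 2 ≤ v.ofLp ⬝ᵥ (homogenizeCell A *ᵥ v.ofLp) := by
  have h1 := (isElliptic_matrixField hA hel).le_effectiveForm hl v
  have hv : v = ∑ i, v i • EuclideanSpace.single i (1 : ℝ) := by
    have := (EuclideanSpace.basisFun (Fin d) ℝ).sum_repr v
    simpa using this.symm
  have h2 := effectiveForm_sum_sum (matrixField A hA) Finset.univ (fun i => v i)
    (fun i => EuclideanSpace.single i (1 : ℝ))
  rw [← hv] at h2
  rw [h2] at h1
  simpa only [dotProduct, Matrix.mulVec, homogenizeCell_apply hA hl hel] using h1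

theorem contDiff_homogenizeCell {E : Type*} [NormedAddCommGroup E] [NormedSpace ℝ E]
    {A : E → Space d → Matrix (Fin d) (Fin d) ℝ} {l : E → ℝ}
    (hA : ∀ i j, ContDiff ℝ 1 fun p : E × Space d => A p.1 p.2 i j) (hl : ∀ x, 0 < l x)
    (hel : ∀ x z (v : Space d), l x * ‖v‖ ^ 2 ≤ v.ofLp ⬝ᵥ (A x z *ᵥ v.ofLp)) (i j : Fin d) :
    ContDiff ℝ 1 fun x => homogenizeCell (A x) i j := by
  have hAc : ∀ x i j, Continuous fun z => A x z i j := fun x i j =>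
    (hA i j).continuous.comp (by fun_prop : Continuous fun z : Space d => (x, z))
  have h1 : ∀ x, homogenizeCell (A x) i j = effectiveForm (matrixField (A x) (hAc x))
      (EuclideanSpace.single i 1) (EuclideanSpace.single j 1) := fun x =>
    homogenizeCell_apply (hAc x) (hl x) (hel x) i j
  simp only [h1]
  exact contDiff_effectiveForm (a := fun x => matrixField (A x) (hAc x))
    (contDiff_toEuclideanCLM hA) hl (fun x => isElliptic_matrixField (hAc x) (hel x)) _ _

/-- Families of elliptic matrix fields, continuously differentiable in all variables. -/
structure IsEllipticFamily {E : Type*} [NormedAddCommGroup E] [NormedSpace ℝ E] {n : ℕ} (l : E → ℝ)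
    (K : E → (Fin n → Space d) → Matrix (Fin d) (Fin d) ℝ) : Prop where
  contDiff : ∀ i j, ContDiff ℝ 1 fun p : E × (Fin n → Space d) => K p.1 p.2 i j
  le : ∀ x y (v : Space d), l x * ‖v‖ ^ 2 ≤ v.ofLp ⬝ᵥ (K x y *ᵥ v.ofLp)

variable {E : Type*} [NormedAddCommGroup E] [NormedSpace ℝ E] {l : E → ℝ}

lemma contDiff_snoc {n : ℕ} : ContDiff ℝ 1 fun p : (E × (Fin n → Space d)) × Space d =>
    (p.1.1, (Fin.snoc (α := fun _ => Space d) p.1.2 p.2 : Fin (n + 1) → Space d)) := by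
  refine (contDiff_fst.comp contDiff_fst).prodMk (contDiff_pi.2 fun k => ?_)
  refine Fin.lastCases ?_ (fun k => ?_) k
  · simp only [Fin.snoc_last]
    exact contDiff_snd
  · simp only [Fin.snoc_castSucc]
    exact (contDiff_apply ℝ (Space d) k).comp (contDiff_snd.comp contDiff_fst)

/-- The slower variables `y` join `x` as parameters of the cell problem, while the bound `l` depends
on `x` alone and is inherited unchanged. -/
lemma IsEllipticFamily.homogenizeCell {n : ℕ}
    {K : E → (Fin (n + 1) → Space d) → Matrix (Fin d) (Fin d) ℝ} (hK : IsEllipticFamily l K)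
    (hl : ∀ x, 0 < l x) :
    IsEllipticFamily l fun x y =>
      homogenizeCell fun z => K x (Fin.snoc (α := fun _ => Space d) y z) := by
  have hc : ∀ i j, ContDiff ℝ 1 fun p : (E × (Fin n → Space d)) × Space d =>
      K p.1.1 (Fin.snoc (α := fun _ => Space d) p.1.2 p.2) i j := fun i j =>
    (hK.contDiff i j).comp contDiff_snoc
  have hA : ∀ x y i j, Continuous fun z =>
      K x (Fin.snoc (α := fun _ => Space d) y z) i j := fun x y i j =>
    (hc i j).continuous.comp (by fun_prop : Continuous fun z : Space d => ((x, y), z))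
  refine ⟨fun i j => ?_, fun x y v => ?_⟩
  · exact contDiff_homogenizeCell (E := E × (Fin n → Space d)) (l := fun p => l p.1)
      (A := fun p z => K p.1 (Fin.snoc (α := fun _ => Space d) p.2 z)) hc (fun p => hl p.1)
      (fun p z v => hK.le _ _ v) i j
  · exact le_homogenizeCell (hA x y) (hl x) (fun z v => hK.le _ _ v) v

theorem IsEllipticFamily.reiterated (hl : ∀ x, 0 < l x) {n : ℕ}
    {K : E → (Fin n → Space d) → Matrix (Fin d) (Fin d) ℝ} (hK : IsEllipticFamily l K) :
    (∀ i j, ContDiff ℝ 1 fun x => reiteratedHomogenize n (K x) i j) ∧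
      ∀ x (v : Space d), l x * ‖v‖ ^ 2 ≤ v.ofLp ⬝ᵥ (reiteratedHomogenize n (K x) *ᵥ v.ofLp) := by
  induction n with
  | zero =>
    exact ⟨fun i j => (hK.contDiff i j).comp (contDiff_id.prodMk contDiff_const),
      fun x v => hK.le x _ v⟩
  | succ n ih => exact ih (hK.homogenizeCell hl)

end MatrixFields

/-! ### Perturbation of the Poincare inequality -/

section Perturbation

variable {d : ℕ} {σ : ℝ}

lemma IsDiffusionSemigroup.congr {μ : Measure (Space d)} {L L' : (Space d → ℝ) → Space d → ℝ}
    {P : ℝ≥0 → Lp ℝ 2 μ →L[ℝ] Lp ℝ 2 μ} (hP : IsDiffusionSemigroup μ L P)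
    (h : ∀ f, IsTestFunction f → L f = L' f) : IsDiffusionSemigroup μ L' P := by
  refine ⟨hP.zero, hP.add, hP.continuous, ?_⟩
  rw [hP.generator]
  congr 1
  ext p
  refine exists_congr fun f => and_congr_right fun hf => ?_
  rw [h f hf]

lemma IsTestFunction.memLp_gradient {μ : Measure (Space d)} [IsProbabilityMeasure μ]
    {f : Space d → ℝ} (hf : IsTestFunction f) (p : ℝ≥0∞) : MemLp (gradient f) p μ :=
  hf.continuous_gradient.memLp_of_hasCompactSupport hf.2.gradient

/-- Holley-Stroock: the variance under `W` is compared with that under `V`, the Poincaré inequality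
is applied there, and the energy is compared back. The constant `κ` measures ellipticity of `B`
relative to the weight. -/
theorem IsDiffusionSemigroup.variance_le_of_perturbation (hσ : 0 < σ) {ρ κ m M : ℝ} (hρ : 0 < ρ)
    (hκ : 0 ≤ κ) {V W : Space d → ℝ} (hV : Continuous V)
    (hVi : Integrable fun x => Real.exp (-V x / σ))
    (hWi : Integrable fun x => Real.exp (-W x / σ))
    (hm : ∀ x, m ≤ W x - V x) (hM : ∀ x, W x - V x ≤ M)
    {B : Space d → Matrix (Fin d) (Fin d) ℝ} (hB : ∀ i j, ContDiff ℝ 1 fun x => B x i j)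
    (hBκ : ∀ x (v : Space d), κ * Real.exp (-W x / σ) * ‖v‖ ^ 2 ≤ v.ofLp ⬝ᵥ (B x *ᵥ v.ofLp))
    {P : ℝ≥0 → Lp ℝ 2 (gibbs σ W) →L[ℝ] Lp ℝ 2 (gibbs σ W)}
    (hP : IsDiffusionSemigroup (gibbs σ W)
      (divergenceFormOperator σ (fun x => Real.exp (-W x / σ)) B) P)
    (hPI : PoincareInequality (gibbs σ V) (σ / ρ)) {f : Space d → ℝ}
    (hf : MemLp f 2 (gibbs σ V)) :
    ∃ hf : MemLp f 2 (gibbs σ W), ∀ t : ℝ≥0, Var[P t (hf.toLp f); gibbs σ W] ≤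
      Real.exp (-2 * (ρ * κ * Real.exp (-2 * (M - m) / σ)) * t) * Var[f; gibbs σ W] := by
  have := isProbabilityMeasure_gibbs hVi
  have := isProbabilityMeasure_gibbs hWi
  set k := Real.exp ((M - m) / σ) with hk
  have hk0 : 0 < k := Real.exp_pos _
  have hWV : gibbs σ W ≤ ENNReal.ofReal k • gibbs σ V := gibbs_le_smul hσ hVi hWi hm hM
  have hVW : gibbs σ V ≤ ENNReal.ofReal k • gibbs σ W := by
    -- Exchanging the potentials negates the bounds but keeps the oscillation, so `k` serves both
    -- ways.
    have := gibbs_le_smul hσ hWi hVi (m := -M) (M := -m) (fun x => by linarith [hM x])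
      (fun x => by linarith [hm x])
    rwa [show -m - -M = M - m by ring] at this
  have hk2 : Real.exp (-2 * (M - m) / σ) = (k ^ 2)⁻¹ := by
    rw [hk, ← Real.exp_nat_mul, ← Real.exp_neg]
    congr 1
    push_cast
    ring
  refine ⟨hf.of_measure_le_smul ENNReal.ofReal_ne_top hWV, fun t => ?_⟩
  refine hP.variance_le (fun g hg => ?_) (fun g hg => integral_divergenceFormOperator hB hg)
    (fun g hg => ?_) _ t
  -- The bound `W ≤ V + M` supplies a continuous minorant of the possibly discontinuous weight.
  · refine memLp_divergenceFormOperator hB hWi (U := fun x => -(V x + M) / σ) (by fun_prop)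
      (fun x => ?_) hg 2
    gcongr
    linarith [hM x]
  · have hgrad : ∀ {μ : Measure (Space d)} [IsProbabilityMeasure μ],
        Integrable (fun x => ‖gradient g x‖ ^ 2) μ := (hg.memLp_gradient 2).integrable_norm_pow
          (by norm_num)
    have h1 : Var[g; gibbs σ W] ≤ k * Var[g; gibbs σ V] :=
      variance_le_mul_of_le_smul hk0.le hWV (hg.memLp 2)
    have h2 := hPI g (gradient g) (hg.memLp 2) (hg.memLp_gradient 2) hg.isWeakGradient
    have h3 : ∫ x, ‖gradient g x‖ ^ 2 ∂(gibbs σ V) ≤ k * ∫ x, ‖gradient g x‖ ^ 2 ∂(gibbs σ W) :=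
      integral_le_mul_of_le_smul hk0.le hVW hgrad fun x => sq_nonneg _
    have h4 : κ * ∫ x, ‖gradient g x‖ ^ 2 ∂(gibbs σ W) ≤ ∫ x, (Real.exp (-W x / σ))⁻¹ *
        ⟪gradient g x, WithLp.toLp 2 (B x *ᵥ (gradient g x).ofLp)⟫_ℝ ∂(gibbs σ W) := by
      rw [← integral_const_mul]
      refine integral_mono_of_nonneg (Eventually.of_forall fun x => by positivity) ?_
        (Eventually.of_forall fun x => ?_)
      · refine (integrable_tilted_iff hWi _).2 ?_
        have hF := hg.contDiff_flux hB
        have hc : Integrable fun x => ⟪gradient g x,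
            (WithLp.toLp 2 (B x *ᵥ (gradient g x).ofLp) : Space d)⟫_ℝ := by
          refine (hg.continuous_gradient.inner (𝕜 := ℝ) hF.continuous).integrable_of_hasCompactSupport
            (hg.2.gradient.mono fun x hx h => hx ?_)
          simp [h]
        refine hc.congr (Eventually.of_forall fun x => ?_)
        exact (mul_inv_cancel_left₀ (Real.exp_pos _).ne' _).symm
      · simp only
        rw [inner_eq_dotProduct, ← div_eq_inv_mul, le_div_iff₀ (Real.exp_pos _)]
        linarith [hBκ x (gradient g x)]
    rw [integral_mul_divergenceFormOperator hB hg hg.contDiff_one, neg_neg, hk2]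
    calc ρ * κ * (k ^ 2)⁻¹ * Var[g; gibbs σ W]
        ≤ ρ * κ * (k ^ 2)⁻¹ * (k * (σ / ρ * (k * ∫ x, ‖gradient g x‖ ^ 2 ∂(gibbs σ W)))) := by
          refine mul_le_mul_of_nonneg_left (h1.trans ?_) (by positivity)
          refine mul_le_mul_of_nonneg_left (h2.trans ?_) hk0.le
          exact mul_le_mul_of_nonneg_left h3 (by positivity)
      _ = σ * (κ * ∫ x, ‖gradient g x‖ ^ 2 ∂(gibbs σ W)) := by
          generalize (∫ x, ‖gradient g x‖ ^ 2 ∂(gibbs σ W)) = I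
          field_simp
      _ ≤ _ := mul_le_mul_of_nonneg_left h4 hσ.le

/-- Exponential decay for the Langevin dynamics implies the Poincare inequality. -/
theorem IsDiffusionSemigroup.poincareInequality_of_decay (hσ : 0 < σ) {ρ : ℝ} (hρ : 0 < ρ)
    {V : Space d → ℝ} (hV : ContDiff ℝ ∞ V) (hVi : Integrable fun x => Real.exp (-V x / σ))
    {P : ℝ≥0 → Lp ℝ 2 (gibbs σ V) →L[ℝ] Lp ℝ 2 (gibbs σ V)}
    (hP : IsDiffusionSemigroup (gibbs σ V)
      (divergenceFormOperator σ (fun x => Real.exp (-V x / σ))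
        fun x => Real.exp (-V x / σ) • 1) P)
    (hdecay : ∀ (f : Space d → ℝ) (hf : MemLp f 2 (gibbs σ V)) (t : ℝ≥0),
      Var[P t (hf.toLp f); gibbs σ V] ≤ Real.exp (-2 * ρ * t) * Var[f; gibbs σ V]) :
    PoincareInequality (gibbs σ V) (σ / ρ) := by
  have := isProbabilityMeasure_gibbs hVi
  have hw : ContDiff ℝ ∞ fun x => Real.exp (-V x / σ) := (hV.neg.div_const σ).exp
  have hB : ∀ i j, ContDiff ℝ ∞ fun x =>
      (Real.exp (-V x / σ) • (1 : Matrix (Fin d) (Fin d) ℝ)) i j := fun i j => by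
    simp only [Matrix.smul_apply, smul_eq_mul]
    exact hw.mul contDiff_const
  have hB1 : ∀ i j, ContDiff ℝ 1 fun x =>
      (Real.exp (-V x / σ) • (1 : Matrix (Fin d) (Fin d) ℝ)) i j := fun i j =>
    (hB i j).of_le (by simp)
  -- The Gibbs density is continuous and positive, so it can be divided out locally.
  have hloc : ∀ {F : Type} [NormedAddCommGroup F] [NormedSpace ℝ F] (f : Space d → F),
      MemLp f 2 (gibbs σ V) → LocallyIntegrable f := by
    intro F _ _ f hf
    have h1 := (integrable_tilted_iff hVi f).1 (hf.integrable (by norm_num))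
    have h2 := h1.locallyIntegrable.continuous_smul
      (hw.continuous.inv₀ fun x => (Real.exp_pos _).ne')
    refine h2.congr (Eventually.of_forall fun x => ?_)
    exact inv_smul_smul₀ (Real.exp_pos _).ne' _
  have hflux : ∀ (g : Space d → ℝ) x, WithLp.toLp 2 ((Real.exp (-V x / σ) •
      (1 : Matrix (Fin d) (Fin d) ℝ)) *ᵥ (gradient g x).ofLp) =
      Real.exp (-V x / σ) • gradient g x := fun g x => by
    rw [Matrix.smul_mulVec, Matrix.one_mulVec]; rfl
  intro f G hf hG hfG
  have key : ∀ g, IsTestFunction g → ∀ (f : Space d → ℝ) (G : Space d → Space d),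
      MemLp f 2 (gibbs σ V) → MemLp G 2 (gibbs σ V) → IsWeakGradient f G →
      ∫ x, f x * divergenceFormOperator σ (fun x => Real.exp (-V x / σ))
        (fun x => Real.exp (-V x / σ) • 1) g x ∂(gibbs σ V) =
      -(σ * ∫ x, ⟪G x, gradient g x⟫_ℝ ∂(gibbs σ V)) := by
    intro g hg f G hf hG hfG
    have h1 := hfG.integral_mul_divergence (hloc f hf) (hloc G hG)
      (contDiff_flux hB (f := g) (hg.1.of_le le_rfl)) (hasCompactSupport_flux hg.2)
    have h2 : ∀ x, Real.exp (-V x / σ) * (f x * divergenceFormOperator σ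
        (fun x => Real.exp (-V x / σ)) (fun x => Real.exp (-V x / σ) • 1) g x) =
        σ * (f x * divergence (fun z => WithLp.toLp 2 ((Real.exp (-V z / σ) •
          (1 : Matrix (Fin d) (Fin d) ℝ)) *ᵥ (gradient g z).ofLp)) x) := by
      intro x
      have := (Real.exp_pos (-V x / σ)).ne'
      rw [divergenceFormOperator]
      generalize Real.exp (-V x / σ) = w at *
      field_simp
    rw [integral_gibbs, integral_gibbs]
    simp only [h2]
    rw [integral_const_mul, h1]
    simp only [hflux, inner_smul_right]
    ring
  have hself : ∀ g, IsTestFunction g →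
      -∫ x, g x * divergenceFormOperator σ (fun x => Real.exp (-V x / σ))
        (fun x => Real.exp (-V x / σ) • 1) g x ∂(gibbs σ V) =
      σ * ∫ x, ‖gradient g x‖ ^ 2 ∂(gibbs σ V) := by
    intro g hg
    rw [key g hg g (gradient g) (hg.memLp 2) (hg.memLp_gradient 2) hg.isWeakGradient, neg_neg]
    simp only [real_inner_self_eq_norm_sq]
  have hcs : ∀ g, IsTestFunction g → (∫ x, ⟪G x, gradient g x⟫_ℝ ∂(gibbs σ V)) ^ 2 ≤
      (∫ x, ‖G x‖ ^ 2 ∂(gibbs σ V)) * ∫ x, ‖gradient g x‖ ^ 2 ∂(gibbs σ V) := by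
    intro g hg
    have hinner : ∀ {u v : Space d → Space d} (hu : MemLp u 2 (gibbs σ V))
        (hv : MemLp v 2 (gibbs σ V)), ⟪hu.toLp u, hv.toLp v⟫_ℝ =
          ∫ x, ⟪u x, v x⟫_ℝ ∂(gibbs σ V) := by
      intro u v hu hv
      rw [L2.inner_def]
      refine integral_congr_ae ?_
      filter_upwards [hu.coeFn_toLp, hv.coeFn_toLp] with x h1 h2
      rw [h1, h2]
    have h1 := real_inner_mul_inner_self_le (hG.toLp G)
      ((hg.memLp_gradient 2).toLp (gradient g))
    simp only [hinner, real_inner_self_eq_norm_sq] at h1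
    rwa [pow_two]
  -- The pairing with `f` is `-σ ∫ ⟪G, ∇g⟫` and the energy of `g` is `σ ∫ |∇g|²`, so Cauchy-Schwarz
  -- gives this `S`.
  have hmain := hP.mul_variance_le (c := ρ)
    (fun g hg => memLp_divergenceFormOperator hB1 hVi (U := fun x => -V x / σ)
      (by have := hV.continuous; fun_prop) (fun x => le_rfl) hg 2)
    (fun g hg => integral_divergenceFormOperator hB1 hg)
    (fun g hg => by rw [hself g hg]; positivity) hdecay hf
    (S := σ * ∫ x, ‖G x‖ ^ 2 ∂(gibbs σ V)) (by positivity)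
    (fun g hg => by
      rw [hself g hg, key g hg f G hf hG hfG, neg_sq, mul_pow]
      have := hcs g hg
      nlinarith [mul_le_mul_of_nonneg_left this (sq_nonneg σ)])
  rw [div_mul_eq_mul_div, le_div_iff₀ hρ, mul_comm]
  exact hmain

end Perturbation

/-! ### The multiscale potential -/

section Multiscale

variable {d N : ℕ} {σ : ℝ} {V₀ : Space d → ℝ} {V₁ : Space d × (Fin N → Space d) → ℝ}

lemma volume_pi_unitCell : volume {y : Fin N → Space d | ∀ k, y k ∈ unitCell d} = 1 := by
  have : {y : Fin N → Space d | ∀ k, y k ∈ unitCell d} = Set.univ.pi fun _ => unitCell d := by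
    ext; simp
  rw [this, volume_pi, Measure.pi_pi]
  simp [volume_unitCell]

namespace IsMultiscalePotential

variable (hV : IsMultiscalePotential σ V₀ V₁)
include hV

lemma iInf_le (p : Space d × (Fin N → Space d)) : ⨅ q, V₁ q ≤ V₁ p := by
  obtain ⟨C, hC⟩ := hV.bounded₁
  exact ciInf_le ⟨-C, by rintro _ ⟨q, rfl⟩; exact (abs_le.1 (hC q)).1⟩ p

lemma le_iSup (p : Space d × (Fin N → Space d)) : V₁ p ≤ ⨆ q, V₁ q := by
  obtain ⟨C, hC⟩ := hV.bounded₁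
  exact le_ciSup ⟨C, by rintro _ ⟨q, rfl⟩; exact (abs_le.1 (hC q)).2⟩ p

lemma contDiff_multiscalePotential (ε : ℝ) : ContDiff ℝ ∞ (multiscalePotential V₀ V₁ ε) := by
  refine hV.smooth₀.add (hV.smooth₁.comp (contDiff_id.prodMk (contDiff_pi.2 fun k => ?_)))
  exact contDiff_id.const_smul (ε ^ (k.val + 1))⁻¹

lemma integrable_of_le (hσ : 0 < σ) {W : Space d → ℝ} (hW : Measurable W) {m : ℝ}
    (hm : ∀ x, m ≤ W x - V₀ x) : Integrable fun x => Real.exp (-W x / σ) := by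
  refine (hV.integrable₀.const_mul (Real.exp (-m / σ))).mono'
    (by fun_prop) (Eventually.of_forall fun x => ?_)
  rw [Real.norm_eq_abs, Real.abs_exp, ← Real.exp_add, ← add_div]
  gcongr
  linarith [hm x]

lemma measurable_partitionFunction : Measurable (partitionFunction σ V₀ V₁) := by
  have hc : Continuous fun p : Space d × (Fin N → Space d) =>
      Real.exp (-(V₀ p.1 + V₁ (p.1, p.2)) / σ) := by
    have h0 := hV.smooth₀.continuous
    have h1 := hV.smooth₁.continuous
    fun_prop
  exact (hc.stronglyMeasurable.integral_prod_right
    (ν := volume.restrict {y : Fin N → Space d | ∀ k, y k ∈ unitCell d})).measurable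

lemma partitionFunction_mem (hσ : 0 < σ) (x : Space d) :
    partitionFunction σ V₀ V₁ x ∈ Set.Icc (Real.exp (-(V₀ x + ⨆ p, V₁ p) / σ))
      (Real.exp (-(V₀ x + ⨅ p, V₁ p) / σ)) := by
  have : IsProbabilityMeasure (volume.restrict {y : Fin N → Space d | ∀ k, y k ∈ unitCell d}) :=
    ⟨by rw [Measure.restrict_apply_univ, volume_pi_unitCell]⟩
  have hc : Continuous fun y : Fin N → Space d => Real.exp (-(V₀ x + V₁ (x, y)) / σ) := by
    have h1 := hV.smooth₁.continuous
    fun_prop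
  have hle : ∀ y, Real.exp (-(V₀ x + V₁ (x, y)) / σ) ≤ Real.exp (-(V₀ x + ⨅ p, V₁ p) / σ) := by
    intro y
    gcongr
    exact hV.iInf_le _
  have hge : ∀ y, Real.exp (-(V₀ x + ⨆ p, V₁ p) / σ) ≤ Real.exp (-(V₀ x + V₁ (x, y)) / σ) := by
    intro y
    gcongr
    exact hV.le_iSup _
  have hint : Integrable (fun y : Fin N → Space d => Real.exp (-(V₀ x + V₁ (x, y)) / σ))
      (volume.restrict {y : Fin N → Space d | ∀ k, y k ∈ unitCell d}) := by
    refine Integrable.of_bound hc.aestronglyMeasurable (Real.exp (-(V₀ x + ⨅ p, V₁ p) / σ))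
      (Eventually.of_forall fun y => ?_)
    rw [Real.norm_eq_abs, Real.abs_exp]
    exact hle y
  constructor
  · simpa [partitionFunction] using integral_mono (integrable_const _) hint hge
  · simpa [partitionFunction] using integral_mono hint (integrable_const _) hle

lemma partitionFunction_pos (hσ : 0 < σ) (x : Space d) : 0 < partitionFunction σ V₀ V₁ x :=
  (Real.exp_pos _).trans_le (hV.partitionFunction_mem hσ x).1

lemma exp_freeEnergy (hσ : 0 < σ) (x : Space d) :
    Real.exp (-freeEnergy σ V₀ V₁ x / σ) = partitionFunction σ V₀ V₁ x := by
  rw [freeEnergy, neg_mul, neg_neg, mul_div_cancel_left₀ _ hσ.ne',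
    Real.exp_log (hV.partitionFunction_pos hσ x)]

lemma freeEnergy_sub_mem (hσ : 0 < σ) (x : Space d) :
    freeEnergy σ V₀ V₁ x - V₀ x ∈ Set.Icc (⨅ p, V₁ p) (⨆ p, V₁ p) := by
  have h := hV.partitionFunction_mem hσ x
  rw [← hV.exp_freeEnergy hσ, Set.mem_Icc, Real.exp_le_exp, Real.exp_le_exp,
    div_le_div_iff_of_pos_right hσ, div_le_div_iff_of_pos_right hσ] at h
  exact ⟨by linarith [h.2], by linarith [h.1]⟩

lemma isEllipticFamily (hσ : 0 < σ) :
    IsEllipticFamily (fun x => Real.exp (-(V₀ x + ⨆ p, V₁ p) / σ))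
      fun x (y : Fin N → Space d) =>
        Real.exp (-(V₀ x + V₁ (x, y)) / σ) • (1 : Matrix (Fin d) (Fin d) ℝ) := by
  refine ⟨fun i j => ?_, fun x y v => ?_⟩
  · simp only [Matrix.smul_apply, smul_eq_mul]
    have h0 : ContDiff ℝ 1 V₀ := hV.smooth₀.of_le (by simp)
    have h1 : ContDiff ℝ 1 V₁ := hV.smooth₁.of_le (by simp)
    exact ((((h0.comp contDiff_fst).add h1).neg.div_const σ).exp).mul contDiff_const
  · rw [Matrix.smul_mulVec, Matrix.one_mulVec, dotProduct_smul, ← inner_eq_dotProduct,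
      real_inner_self_eq_norm_sq, smul_eq_mul]
    gcongr
    exact hV.le_iSup _

/-- The factor `Z⁻¹` in the effective tensor cancels against `Z` in the flux, leaving the reiterated
coefficient as `B`. -/
lemma homogenizedOperator_eq (hσ : 0 < σ) (f : Space d → ℝ) :
    homogenizedOperator σ V₀ V₁ f =
      divergenceFormOperator σ (fun x => Real.exp (-freeEnergy σ V₀ V₁ x / σ))
        (fun x => reiteratedHomogenize N fun y =>
          Real.exp (-(V₀ x + V₁ (x, y)) / σ) • (1 : Matrix (Fin d) (Fin d) ℝ)) f := by
  ext x
  rw [homogenizedOperator, divergenceFormOperator, hV.exp_freeEnergy hσ]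
  congr 2
  ext1 z
  rw [effectiveDiffusion, ← WithLp.toLp_smul, ← Matrix.smul_mulVec,
    smul_inv_smul₀ (hV.partitionFunction_pos hσ z).ne']

end IsMultiscalePotential

end Multiscale

end

/-! ### Assembly of the equivalence and the two decay rates -/

theorem mainTheorem5 {d N : ℕ} {σ ρ : ℝ} (hσ : 0 < σ) (hρ : 0 < ρ)
    (V₀ : Space d → ℝ) (V₁ : Space d × (Fin N → Space d) → ℝ)
    (hV : IsMultiscalePotential σ V₀ V₁) :
    -- the Poincare inequality for the reference measure is equivalent to exponential decay
    (∀ P, IsDiffusionSemigroup (gibbs σ V₀) (langevinOperator σ V₀) P →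
      (PoincareInequality (gibbs σ V₀) (σ / ρ) ↔
        ∀ (f : Space d → ℝ) (hf : MemLp f 2 (gibbs σ V₀)) (t : ℝ≥0),
          Var[P t (hf.toLp f); gibbs σ V₀] ≤ Real.exp (-2 * ρ * t) * Var[f; gibbs σ V₀])) ∧
    (PoincareInequality (gibbs σ V₀) (σ / ρ) →
      -- decay of the full dynamics
      (∀ ε : ℝ, 0 < ε →
        ∀ P, IsDiffusionSemigroup (gibbs σ (multiscalePotential V₀ V₁ ε))
            (langevinOperator σ (multiscalePotential V₀ V₁ ε)) P →
          ∀ f : Space d → ℝ, MemLp f 2 (gibbs σ V₀) →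
            ∃ hf : MemLp f 2 (gibbs σ (multiscalePotential V₀ V₁ ε)), ∀ t : ℝ≥0,
              Var[P t (hf.toLp f); gibbs σ (multiscalePotential V₀ V₁ ε)] ≤
                Real.exp (-2 * (ρ * Real.exp (-2 * osc V₁ / σ)) * t) *
                  Var[f; gibbs σ (multiscalePotential V₀ V₁ ε)]) ∧
      -- decay of the homogenized dynamics
      (∀ P, IsDiffusionSemigroup (gibbs σ (freeEnergy σ V₀ V₁)) (homogenizedOperator σ V₀ V₁) P →
        ∀ f : Space d → ℝ, MemLp f 2 (gibbs σ V₀) →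
          ∃ hf : MemLp f 2 (gibbs σ (freeEnergy σ V₀ V₁)), ∀ t : ℝ≥0,
            Var[P t (hf.toLp f); gibbs σ (freeEnergy σ V₀ V₁)] ≤
              Real.exp (-2 * (ρ * Real.exp (-3 * osc V₁ / σ)) * t) *
                Var[f; gibbs σ (freeEnergy σ V₀ V₁)])) := by
  have h₀ := hV.smooth₀.continuous
  have hLangevin : ∀ {W : Space d → ℝ}, ContDiff ℝ ∞ W → ∀ f, IsTestFunction f →
      langevinOperator σ W f = divergenceFormOperator σ (fun x => Real.exp (-W x / σ))
        (fun x => Real.exp (-W x / σ) • 1) f := fun hW f hf =>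
    langevinOperator_eq_divergenceFormOperator hσ.ne' (hW.of_le (by simp))
      (hf.1.of_le ENat.LEInfty.out)
  have hB : ∀ {W : Space d → ℝ}, ContDiff ℝ ∞ W → ∀ i j, ContDiff ℝ 1 fun x =>
      (Real.exp (-W x / σ) • (1 : Matrix (Fin d) (Fin d) ℝ)) i j := fun hW i j => by
    simp only [Matrix.smul_apply, smul_eq_mul]
    exact (((hW.of_le (by simp)).neg.div_const σ).exp).mul contDiff_const
  have hBκ : ∀ (W : Space d → ℝ) x (v : Space d), 1 * Real.exp (-W x / σ) * ‖v‖ ^ 2 ≤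
      v.ofLp ⬝ᵥ ((Real.exp (-W x / σ) • (1 : Matrix (Fin d) (Fin d) ℝ)) *ᵥ v.ofLp) := by
    intro W x v
    rw [Matrix.smul_mulVec, Matrix.one_mulVec, dotProduct_smul, ← inner_eq_dotProduct,
      real_inner_self_eq_norm_sq, smul_eq_mul, one_mul]
  refine ⟨fun P hP => ⟨fun hPI f hf t => ?_, fun hdecay => ?_⟩, fun hPI => ⟨?_, ?_⟩⟩
  -- The unperturbed case: zero oscillation and `κ = 1` leave the rate `ρ` intact.
  · obtain ⟨_, h⟩ := (hP.congr (hLangevin hV.smooth₀)).variance_le_of_perturbation hσ hρ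
      zero_le_one h₀ hV.integrable₀ hV.integrable₀ (m := 0) (M := 0) (by simp) (by simp)
      (hB hV.smooth₀) (hBκ V₀) hPI hf
    simpa using h t
  · exact (hP.congr (hLangevin hV.smooth₀)).poincareInequality_of_decay hσ hρ hV.smooth₀
      hV.integrable₀ hdecay
  · intro ε _ P hP f hf
    have hW := hV.contDiff_multiscalePotential ε
    have hm : ∀ x, ⨅ p, V₁ p ≤ multiscalePotential V₀ V₁ ε x - V₀ x := fun x => by
      rw [multiscalePotential, add_sub_cancel_left]; exact hV.iInf_le _
    have hM : ∀ x, multiscalePotential V₀ V₁ ε x - V₀ x ≤ ⨆ p, V₁ p := fun x => by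
      rw [multiscalePotential, add_sub_cancel_left]; exact hV.le_iSup _
    obtain ⟨hf', h⟩ := (hP.congr (hLangevin hW)).variance_le_of_perturbation hσ hρ
      zero_le_one h₀ hV.integrable₀ (hV.integrable_of_le hσ hW.continuous.measurable hm) hm hM
      (hB hW) (hBκ _) hPI hf
    refine ⟨hf', fun t => ?_⟩
    simpa only [mul_one, osc] using h t
  · intro P hP f hf
    have hm : ∀ x, ⨅ p, V₁ p ≤ freeEnergy σ V₀ V₁ x - V₀ x := fun x =>
      (hV.freeEnergy_sub_mem hσ x).1
    have hM : ∀ x, freeEnergy σ V₀ V₁ x - V₀ x ≤ ⨆ p, V₁ p := fun x =>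
      (hV.freeEnergy_sub_mem hσ x).2
    have hmeas : Measurable (freeEnergy σ V₀ V₁) :=
      hV.measurable_partitionFunction.log.const_mul (-σ)
    obtain ⟨hK, hKge⟩ := (hV.isEllipticFamily hσ).reiterated fun x => Real.exp_pos _
    -- The coefficient is bounded below using `sup V₁` and the weight above using `inf V₁`; their
    -- ratio gives `κ = exp (-osc V₁ / σ)`.
    have hKκ : ∀ x (v : Space d), Real.exp (-osc V₁ / σ) * Real.exp (-freeEnergy σ V₀ V₁ x / σ) *
        ‖v‖ ^ 2 ≤ v.ofLp ⬝ᵥ ((reiteratedHomogenize N fun y =>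
          Real.exp (-(V₀ x + V₁ (x, y)) / σ) • (1 : Matrix (Fin d) (Fin d) ℝ)) *ᵥ v.ofLp) := by
      intro x v
      refine le_trans ?_ (hKge x v)
      rw [← Real.exp_add, ← add_div]
      gcongr
      have := hm x
      rw [osc]
      linarith
    obtain ⟨hf', h⟩ := (hP.congr fun f _ => hV.homogenizedOperator_eq hσ f)
      |>.variance_le_of_perturbation hσ hρ (κ := Real.exp (-osc V₁ / σ)) (Real.exp_pos _).le h₀
      hV.integrable₀ (hV.integrable_of_le hσ hmeas hm) hm hM hK hKκ hPI hf
    refine ⟨hf', fun t => ?_⟩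
    -- One factor from ellipticity of the effective tensor and two from comparing the measures.
    have hexp : ρ * Real.exp (-osc V₁ / σ) * Real.exp (-2 * ((⨆ p, V₁ p) - ⨅ p, V₁ p) / σ) =
        ρ * Real.exp (-3 * osc V₁ / σ) := by
      rw [mul_assoc, ← Real.exp_add]
      congr 2
      rw [osc]
      ring
    have := h t
    rwa [hexp] at this
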